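/- Let $\mathcal C=(\mathcal C,\otimes,\mathbf 1,\Psi)$ be a braided monoidal category and let $(H,\mathrm m_H,\eta_H,\Delta_H,\varepsilon_H,S)$ be a Hopf algebra in $\mathcal C$ whose antipode $S$ is invertible. (Associativity and unit constraints are suppressed.) *Crossed module bialgebras.* A right crossed module over $H$ is an object $X$ with a right $H$-module structure $\mu:X\otimes H\to X$ and a right $H$-comodule structure $\nu:X\to X\otimes H$ such that $$(\mathrm{id}_X\otimes \mathrm m_H)(\Psi_{H,X}\otimes\mathrm{id}_H)(\mathrm{id}_H\otimes\nu\mu)(\Psi_{X,H}\otimes\mathrm{id}_H)(\mathrm{id}_X\otimes\Delta_H)=(\mu\otimes \mathrm m_H)(\mathrm{id}_X\otimes\Psi_{H,H}\otimes\mathrm{id}_H)(\nu\otimes\Delta_H).$$ Morphisms of crossed modules are the module and comodule morphisms. Tensor products carry the diagonal action and coaction, $\mathbf 1$ the trivial ones $(\varepsilon_H,\eta_H)$, and the braiding is $(\mathrm{id}_Y\otimes\mu_X)(\Psi_{X,Y}\otimes\mathrm{id}_H)(\mathrm{id}_X\otimes\nu_Y)$. Let $\mathrm{Bialg}\text{-}\mathcal{DY}(\mathcal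 C)^H_H$ be the category of bialgebras in this braided category, with the bialgebra morphisms in it. *Admissible pairs.* Let $X$ be at the same time an algebra in the category of right $H$-modules and a coalgebra in the category of right $H$-comodules. Put on $H\otimes X$ the cross product algebra structure $$\mathrm m_\ltimes=(\mathrm m_H\otimes \mathrm m_X)\bigl(\mathrm{id}_H\otimes(\mathrm{id}_H\otimes\mu)(\Psi_{X,H}\otimes\mathrm{id}_H)(\mathrm{id}_X\otimes\Delta_H)\otimes\mathrm{id}_X\bigr),\qquad \eta_\ltimes=\eta_H\otimes\eta_X,$$ and the cross coproduct coalgebra structure $$\Delta_\ltimes=\bigl(\mathrm{id}_H\otimes(\mathrm{id}_X\otimes \mathrm m_H)(\Psi_{H,X}\otimes\mathrm{id}_H)(\mathrm{id}_H\otimes\nu)\otimes\mathrm{id}_X\bigr)(\Delta_H\otimes\Delta_X),\qquad \varepsilon_\ltimes=\varepsilon_H\otimes\varepsilon_X.$$ The pair $(H,X)$ is admissible if these structures make $H\ltimes X:=H\otimes X$ a bialgebra in $\mathcal C$. Put $j_X=\mathrm{id}_H\otimes\eta_X$ and $k_X=\mathrm{id}_H\otimes\varepsilon_X$. A morphism $(H,X)\to(H,Y)$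 is a bialgebra morphism $h:H\ltimes X\to H\ltimes Y$ with $h\circ j_X=j_Y$ and $k_Y\circ h=k_X$. This is the category $H\text{-cp-}\mathcal C$. *Coinvariants.* For an admissible pair let $B=H\ltimes X$, with left and right $H$-actions $\mu_l=\mathrm m_\ltimes(j_X\otimes \mathrm{id}_B)$, $\mu_r=\mathrm m_\ltimes(\mathrm{id}_B\otimes j_X)$ and $H$-coactions $\nu_l=(k_X\otimes\mathrm{id}_B)\Delta_\ltimes$, $\nu_r=(\mathrm{id}_B\otimes k_X)\Delta_\ltimes$, and let $\Pi=\mu_l(S\otimes\mathrm{id}_B)\nu_l$. A splitting of $\Pi$ consists of an object ${}_HB$ and morphisms $i:{}_HB\to B$, $p:B\to{}_HB$ with $i\circ p=\Pi$, $p\circ i=\mathrm{id}$. Given a splitting, $F$ sends $(H,X)$ to $B$ with these (co)actions, with multiplication $\mathrm m_\ltimes(\mathrm{id}_B\otimes i):B\otimes{}_HB\to B$, unit $j_X$, comultiplication $(\mathrm{id}_B\otimes p)\Delta_\ltimes$ and counit $k_X$, and is the identity on morphisms; ${}_H(-)$ then gives the object ${}_HB$ with action $p\,\mu_r(i\otimes\mathrm{id}_H)$,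 coaction $(p\otimes\mathrm{id}_H)\nu_r\,i$, multiplication $p\,\mathrm m_\ltimes(i\otimes i)$, unit $p\,j_X\,\eta_H$, comultiplication $(p\otimes p)\Delta_\ltimes\, i$ and counit $\varepsilon_H\,k_X\,i$, and it sends a morphism $h$ to $p\circ h\circ i$. For every admissible pair, $i=\eta_H\otimes\mathrm{id}_X$, $p=\varepsilon_H\otimes\mathrm{id}_X$ is a splitting of $\Pi$ with ${}_HB=X$, called canonical. **Theorem.** The assignment $X\mapsto (H,X)$, $f\mapsto\mathrm{id}_H\otimes f$ is a well-defined functor $H\ltimes(-):\mathrm{Bialg}\text{-}\mathcal{DY}(\mathcal C)^H_H\to H\text{-cp-}\mathcal C$, and for every choice of splittings ${}_H(-)\circ F$ is a well-defined functor $H\text{-cp-}\mathcal C\to\mathrm{Bialg}\text{-}\mathcal{DY}(\mathcal C)^H_H$. For the canonical splittings these two functors are mutually inverse isomorphisms of categories; for any other choice of splittings ${}_H(-)\circ F$ is naturally isomorphic to the functor formed with the canonical ones. -/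

import Mathlib

open CategoryTheory MonoidalCategory
open scoped MonObj ComonObj HopfObj

universe v u

namespace BraidedCross

/-- A splitting of an endomorphism `e`: `i ≫ p = 𝟙` and `p ≫ i = e` (diagrammatic order);
it exists only if `e` is idempotent. -/
structure IdempotentSplitting {C : Type u} [Category.{v} C] {X : C} (e : X ⟶ X) where
  Y : C
  i : Y ⟶ X
  p : X ⟶ Y
  i_p : i ≫ p = 𝟙 Y
  p_i : p ≫ i = e

theorem IdempotentSplitting.e_p {C : Type u} [Category.{v} C] {X : C} {e : X ⟶ X} (s : IdempotentSplitting e) :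
    e ≫ s.p = s.p := by
  have h : (s.p ≫ s.i) ≫ s.p = s.p := by rw [Category.assoc, s.i_p, Category.comp_id]
  exact (congrArg (· ≫ s.p) s.p_i).symm.trans h

section Basic

variable {C : Type u} [Category.{v} C] [MonoidalCategory.{v} C]

/-- `(A, m, e)` is an algebra (monoid object) in `C`. -/
def IsAlgebra {A : C} (m : A ⊗ A ⟶ A) (e : 𝟙_ C ⟶ A) : Prop :=
  ∃ s : MonObj A, s.mul = m ∧ s.one = e

/-- `(A, d, c)` is a coalgebra (comonoid object) in `C`. -/
def IsCoalgebra {A : C} (d : A ⟶ A ⊗ A) (c : A ⟶ 𝟙_ C) : Prop :=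
  ∃ s : ComonObj A, s.comul = d ∧ s.counit = c

/-- `f` is a morphism of algebras. -/
structure IsAlgebraHom {A A' : C} (m : A ⊗ A ⟶ A) (e : 𝟙_ C ⟶ A)
    (m' : A' ⊗ A' ⟶ A') (e' : 𝟙_ C ⟶ A') (f : A ⟶ A') : Prop where
  map_mul : m ≫ f = (f ⊗ₘ f) ≫ m'
  map_one : e ≫ f = e'

/-- `f` is a morphism of coalgebras. -/
structure IsCoalgebraHom {A A' : C} (d : A ⟶ A ⊗ A) (c : A ⟶ 𝟙_ C)
    (d' : A' ⟶ A' ⊗ A') (c' : A' ⟶ 𝟙_ C) (f : A ⟶ A') : Prop where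
  map_comul : f ≫ d' = d ≫ (f ⊗ₘ f)
  map_counit : f ≫ c' = c

/-- Right modules over an algebra `H`. -/
structure IsRightModule {H X : C} [MonObj H] (act : X ⊗ H ⟶ X) : Prop where
  act_one : X ◁ η[H] ≫ act = (ρ_ X).hom
  act_mul : X ◁ μ[H] ≫ act = (α_ X H H).inv ≫ act ▷ H ≫ act

/-- Right comodules over a coalgebra `H`. -/
structure IsRightComodule {H X : C} [ComonObj H] (coact : X ⟶ X ⊗ H) : Prop where
  coact_counit : coact ≫ X ◁ ε[H] = (ρ_ X).inv
  coact_comul : coact ≫ X ◁ Δ[H] = coact ≫ coact ▷ H ≫ (α_ X H H).hom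

/-- `f` is a morphism of right `H`-modules. -/
def IsModuleHom {H X Y : C} (actX : X ⊗ H ⟶ X) (actY : Y ⊗ H ⟶ Y) (f : X ⟶ Y) : Prop :=
  actX ≫ f = f ▷ H ≫ actY

/-- `f` is a morphism of right `H`-comodules. -/
def IsComoduleHom {H X Y : C} (coactX : X ⟶ X ⊗ H) (coactY : Y ⟶ Y ⊗ H) (f : X ⟶ Y) : Prop :=
  f ≫ coactY = coactX ≫ f ▷ H

theorem IsAlgebraHom.id {A : C} (m : A ⊗ A ⟶ A) (e : 𝟙_ C ⟶ A) :
    IsAlgebraHom m e m e (𝟙 A) := ⟨by simp, by simp⟩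

theorem IsCoalgebraHom.id {A : C} (d : A ⟶ A ⊗ A) (c : A ⟶ 𝟙_ C) :
    IsCoalgebraHom d c d c (𝟙 A) := ⟨by simp, by simp⟩

theorem IsAlgebraHom.comp {A A' A'' : C} {m : A ⊗ A ⟶ A} {e : 𝟙_ C ⟶ A}
    {m' : A' ⊗ A' ⟶ A'} {e' : 𝟙_ C ⟶ A'} {m'' : A'' ⊗ A'' ⟶ A''} {e'' : 𝟙_ C ⟶ A''}
    {f : A ⟶ A'} {g : A' ⟶ A''} (hf : IsAlgebraHom m e m' e' f)
    (hg : IsAlgebraHom m' e' m'' e'' g) : IsAlgebraHom m e m'' e'' (f ≫ g) where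
  map_mul := by
    rw [← Category.assoc, hf.map_mul, Category.assoc, hg.map_mul]
    simp only [MonoidalCategory.tensorHom_comp_tensorHom_assoc]
  map_one := by rw [← Category.assoc, hf.map_one, hg.map_one]

theorem IsCoalgebraHom.comp {A A' A'' : C} {d : A ⟶ A ⊗ A} {c : A ⟶ 𝟙_ C}
    {d' : A' ⟶ A' ⊗ A'} {c' : A' ⟶ 𝟙_ C} {d'' : A'' ⟶ A'' ⊗ A''} {c'' : A'' ⟶ 𝟙_ C}
    {f : A ⟶ A'} {g : A' ⟶ A''} (hf : IsCoalgebraHom d c d' c' f)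
    (hg : IsCoalgebraHom d' c' d'' c'' g) : IsCoalgebraHom d c d'' c'' (f ≫ g) where
  map_comul := by
    rw [Category.assoc, hg.map_comul, ← Category.assoc, hf.map_comul, Category.assoc]
    simp only [MonoidalCategory.tensorHom_comp_tensorHom]
  map_counit := by rw [Category.assoc, hg.map_counit, hf.map_counit]

variable [BraidedCategory C]

/-- `(B, m, e, d, c)` is a bialgebra in the braided category `C`. -/
def IsBialgebra {B : C} (m : B ⊗ B ⟶ B) (e : 𝟙_ C ⟶ B) (d : B ⟶ B ⊗ B) (c : B ⟶ 𝟙_ C) : Prop :=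
  ∃ s : BimonObj B, s.mul = m ∧ s.one = e ∧ s.comul = d ∧ s.counit = c

/-- The diagonal right action of `H` on `X ⊗ Y`. -/
def diagAct {H X Y : C} [ComonObj H] (actX : X ⊗ H ⟶ X) (actY : Y ⊗ H ⟶ Y) :
    (X ⊗ Y) ⊗ H ⟶ X ⊗ Y :=
  (X ⊗ Y) ◁ Δ[H] ≫ tensorμ X Y H H ≫ (actX ⊗ₘ actY)

/-- The diagonal right coaction of `H` on `X ⊗ Y`. -/
def diagCoact {H X Y : C} [MonObj H] (coactX : X ⟶ X ⊗ H) (coactY : Y ⟶ Y ⊗ H) :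
    X ⊗ Y ⟶ (X ⊗ Y) ⊗ H :=
  (coactX ⊗ₘ coactY) ≫ tensorμ X H Y H ≫ (X ⊗ Y) ◁ μ[H]

/-- The trivial right action of `H` on the unit object. -/
def unitAct (H : C) [ComonObj H] : 𝟙_ C ⊗ H ⟶ 𝟙_ C :=
  (λ_ H).hom ≫ ε[H]

/-- The trivial right coaction of `H` on the unit object. -/
def unitCoact (H : C) [MonObj H] : 𝟙_ C ⟶ 𝟙_ C ⊗ H :=
  η[H] ≫ (λ_ H).inv

/-- Right crossed modules (Yetter-Drinfeld modules) over a bialgebra `H`. -/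
structure IsCrossedModule {H X : C} [BimonObj H] (act : X ⊗ H ⟶ X) (coact : X ⟶ X ⊗ H) :
    Prop where
  isRightModule : IsRightModule act
  isRightComodule : IsRightComodule coact
  compatibility :
    X ◁ Δ[H] ≫ (α_ X H H).inv ≫ (β_ X H).hom ▷ H ≫ (α_ H X H).hom ≫ H ◁ (act ≫ coact) ≫
      (α_ H X H).inv ≫ (β_ H X).hom ▷ H ≫ (α_ X H H).hom ≫ X ◁ μ[H] =
    (coact ⊗ₘ Δ[H]) ≫ tensorμ X H H H ≫ (act ⊗ₘ μ[H])

/-- The (pre-)braiding of the category of right crossed modules,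
`(id_Y ⊗ act_X) ∘ (Ψ_{X,Y} ⊗ id_H) ∘ (id_X ⊗ coact_Y)`. -/
def crossedBraiding {H X Y : C} (actX : X ⊗ H ⟶ X) (coactY : Y ⟶ Y ⊗ H) : X ⊗ Y ⟶ Y ⊗ X :=
  X ◁ coactY ≫ (α_ X Y H).inv ≫ (β_ X Y).hom ▷ H ≫ (α_ Y X H).hom ≫ Y ◁ actX

end Basic

variable {C : Type u} [Category.{v} C] [MonoidalCategory.{v} C] [BraidedCategory C]

/-- An object of `C` together with morphisms of the shape of an algebra, a coalgebra, a right
`H`-module and a right `H`-comodule structure. No axioms are imposed here: they are the content of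
the predicates `IsAdmissible` and `IsCrossedModuleBialgebra` below. -/
structure CrossData (H : C) where
  X : C
  mul : X ⊗ X ⟶ X
  one : 𝟙_ C ⟶ X
  comul : X ⟶ X ⊗ X
  counit : X ⟶ 𝟙_ C
  act : X ⊗ H ⟶ X
  coact : X ⟶ X ⊗ H

namespace CrossData

section Bialgebra

variable {H : C} [BimonObj H]

/-- `X` is an algebra in the category of right `H`-modules. -/
structure IsModuleAlgebra (D : CrossData H) : Prop where
  isAlgebra : IsAlgebra D.mul D.one
  isRightModule : IsRightModule D.act
  mul_hom : IsModuleHom (diagAct D.act D.act) D.act D.mul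
  one_hom : IsModuleHom (unitAct H) D.act D.one

/-- `X` is a coalgebra in the category of right `H`-comodules. -/
structure IsComoduleCoalgebra (D : CrossData H) : Prop where
  isCoalgebra : IsCoalgebra D.comul D.counit
  isRightComodule : IsRightComodule D.coact
  comul_hom : IsComoduleHom D.coact (diagCoact D.coact D.coact) D.comul
  counit_hom : IsComoduleHom D.coact (unitCoact H) D.counit

/-- `X ⊗ H ⟶ H ⊗ X`, in Sweedler notation `x ⊗ h ↦ h₁ ⊗ x h₂`. -/
def swap (D : CrossData H) : D.X ⊗ H ⟶ H ⊗ D.X :=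
  D.X ◁ Δ[H] ≫ (α_ D.X H H).inv ≫ (β_ D.X H).hom ▷ H ≫ (α_ H D.X H).hom ≫ H ◁ D.act

/-- `H ⊗ X ⟶ X ⊗ H`, in Sweedler notation `h ⊗ x ↦ x₀ ⊗ h x₁`. -/
def coswap (D : CrossData H) : H ⊗ D.X ⟶ D.X ⊗ H :=
  H ◁ D.coact ≫ (α_ H D.X H).inv ≫ (β_ H D.X).hom ▷ H ≫ (α_ D.X H H).hom ≫ D.X ◁ μ[H]

/-- Multiplication of the cross (smash) product on `H ⊗ X`. -/
def crossMul (D : CrossData H) : (H ⊗ D.X) ⊗ (H ⊗ D.X) ⟶ H ⊗ D.X :=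
  (α_ H D.X (H ⊗ D.X)).hom ≫
    H ◁ ((α_ D.X H D.X).inv ≫ D.swap ▷ D.X ≫ (α_ H D.X D.X).hom) ≫
      (α_ H H (D.X ⊗ D.X)).inv ≫ (μ[H] ⊗ₘ D.mul)

/-- Unit of the cross product. -/
def crossOne (D : CrossData H) : 𝟙_ C ⟶ H ⊗ D.X :=
  (λ_ (𝟙_ C)).inv ≫ (η[H] ⊗ₘ D.one)

/-- Comultiplication of the cross (smash) coproduct on `H ⊗ X`. -/
def crossComul (D : CrossData H) : H ⊗ D.X ⟶ (H ⊗ D.X) ⊗ (H ⊗ D.X) :=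
  (Δ[H] ⊗ₘ D.comul) ≫ (α_ H H (D.X ⊗ D.X)).hom ≫
    H ◁ ((α_ H D.X D.X).inv ≫ D.coswap ▷ D.X ≫ (α_ D.X H D.X).hom) ≫
      (α_ H D.X (H ⊗ D.X)).inv

/-- Counit of the cross coproduct. -/
def crossCounit (D : CrossData H) : H ⊗ D.X ⟶ 𝟙_ C :=
  (ε[H] ⊗ₘ D.counit) ≫ (λ_ (𝟙_ C)).hom

/-- The morphism `j = id_H ⊗ one : H ⟶ H ⊗ X`. -/
def inj (D : CrossData H) : H ⟶ H ⊗ D.X :=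
  (ρ_ H).inv ≫ H ◁ D.one

/-- The morphism `k = id_H ⊗ counit : H ⊗ X ⟶ H`. -/
def proj (D : CrossData H) : H ⊗ D.X ⟶ H :=
  H ◁ D.counit ≫ (ρ_ H).hom

/-- The pair `(H, X)` is admissible: `X` is a right `H`-module algebra and a right `H`-comodule
coalgebra, and the cross product and the cross coproduct make `H ⊗ X` a bialgebra in `C`. -/
structure IsAdmissible (D : CrossData H) : Prop where
  isModuleAlgebra : D.IsModuleAlgebra
  isComoduleCoalgebra : D.IsComoduleCoalgebra
  isBialgebra : IsBialgebra D.crossMul D.crossOne D.crossComul D.crossCounit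

/-- Morphisms of admissible pairs: bialgebra morphisms `h : H ⋉ X ⟶ H ⋉ Y` with `h ∘ j_X = j_Y`
and `k_Y ∘ h = k_X`. -/
structure IsAdmissibleHom (D E : CrossData H) (h : H ⊗ D.X ⟶ H ⊗ E.X) : Prop where
  isAlgebraHom : IsAlgebraHom D.crossMul D.crossOne E.crossMul E.crossOne h
  isCoalgebraHom : IsCoalgebraHom D.crossComul D.crossCounit E.crossComul E.crossCounit h
  inj_comp : D.inj ≫ h = E.inj
  comp_proj : h ≫ E.proj = D.proj

/-- `X` is a bialgebra in the (pre-)braided monoidal category of right crossed modules over `H`: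
it is a crossed module, all its structure morphisms are morphisms of crossed modules (for the
diagonal action and coaction on `X ⊗ X` and the trivial ones on the unit object), it is an algebra
and a coalgebra, and `comul` and `counit` are algebra morphisms, where `X ⊗ X` carries the tensor
product algebra structure formed with the braiding of crossed modules. -/
structure IsCrossedModuleBialgebra (D : CrossData H) : Prop where
  isCrossedModule : IsCrossedModule D.act D.coact
  isAlgebra : IsAlgebra D.mul D.one
  isCoalgebra : IsCoalgebra D.comul D.counit
  mul_moduleHom : IsModuleHom (diagAct D.act D.act) D.act D.mul
  mul_comoduleHom : IsComoduleHom (diagCoact D.coact D.coact) D.coact D.mul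
  one_moduleHom : IsModuleHom (unitAct H) D.act D.one
  one_comoduleHom : IsComoduleHom (unitCoact H) D.coact D.one
  comul_moduleHom : IsModuleHom D.act (diagAct D.act D.act) D.comul
  comul_comoduleHom : IsComoduleHom D.coact (diagCoact D.coact D.coact) D.comul
  counit_moduleHom : IsModuleHom D.act (unitAct H) D.counit
  counit_comoduleHom : IsComoduleHom D.coact (unitCoact H) D.counit
  comul_algebraHom : IsAlgebraHom D.mul D.one
    ((α_ D.X D.X (D.X ⊗ D.X)).hom ≫
      D.X ◁ ((α_ D.X D.X D.X).inv ≫ crossedBraiding D.act D.coact ▷ D.X ≫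
        (α_ D.X D.X D.X).hom) ≫
      (α_ D.X D.X (D.X ⊗ D.X)).inv ≫ (D.mul ⊗ₘ D.mul))
    ((λ_ (𝟙_ C)).inv ≫ (D.one ⊗ₘ D.one)) D.comul
  counit_algebraHom : IsAlgebraHom D.mul D.one (λ_ (𝟙_ C)).hom (𝟙 (𝟙_ C)) D.counit

/-- Morphisms of bialgebras in the category of crossed modules. -/
structure IsCrossedModuleBialgebraHom (D E : CrossData H) (f : D.X ⟶ E.X) : Prop where
  isModuleHom : IsModuleHom D.act E.act f
  isComoduleHom : IsComoduleHom D.coact E.coact f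
  isAlgebraHom : IsAlgebraHom D.mul D.one E.mul E.one f
  isCoalgebraHom : IsCoalgebraHom D.comul D.counit E.comul E.counit f

end Bialgebra

end CrossData

section Categories

variable (H : C) [BimonObj H]

/-- Objects of the category of bialgebras in the category of right crossed modules over `H`. -/
structure CrossedModuleBialgebra where
  data : CrossData H
  property : data.IsCrossedModuleBialgebra

/-- Objects of the category of admissible pairs `(H, X)`. -/
structure AdmissiblePair where
  data : CrossData H
  property : data.IsAdmissible

variable {H}

/-- Morphisms of crossed module bialgebras. -/
@[ext]
structure CrossedModuleBialgebra.Hom (A B : CrossedModuleBialgebra H) where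
  hom : A.data.X ⟶ B.data.X
  property : CrossData.IsCrossedModuleBialgebraHom A.data B.data hom

/-- Morphisms of admissible pairs. -/
@[ext]
structure AdmissiblePair.Hom (A B : AdmissiblePair H) where
  hom : H ⊗ A.data.X ⟶ H ⊗ B.data.X
  property : CrossData.IsAdmissibleHom A.data B.data hom

/-- The category of bialgebras in the category of right crossed modules over `H`. -/
instance : Category (CrossedModuleBialgebra H) where
  Hom A B := CrossedModuleBialgebra.Hom A B
  id A := ⟨𝟙 _, by simp [IsModuleHom], by simp [IsComoduleHom], .id _ _, .id _ _⟩
  comp f g := ⟨f.hom ≫ g.hom, by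
      have h1 := f.property.isModuleHom
      have h2 := g.property.isModuleHom
      unfold IsModuleHom at *
      rw [← Category.assoc, h1, Category.assoc, h2]
      simp, by
      have h1 := f.property.isComoduleHom
      have h2 := g.property.isComoduleHom
      unfold IsComoduleHom at *
      rw [Category.assoc, h2, ← Category.assoc, h1]
      simp, f.property.isAlgebraHom.comp g.property.isAlgebraHom,
      f.property.isCoalgebraHom.comp g.property.isCoalgebraHom⟩
  id_comp _ := CrossedModuleBialgebra.Hom.ext (Category.id_comp _)
  comp_id _ := CrossedModuleBialgebra.Hom.ext (Category.comp_id _)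
  assoc _ _ _ := CrossedModuleBialgebra.Hom.ext (Category.assoc _ _ _)

/-- The category of admissible pairs `(H, X)`. -/
instance : Category (AdmissiblePair H) where
  Hom A B := AdmissiblePair.Hom A B
  id A := ⟨𝟙 _, .id _ _, .id _ _, by simp, by simp⟩
  comp f g := ⟨f.hom ≫ g.hom, f.property.isAlgebraHom.comp g.property.isAlgebraHom,
      f.property.isCoalgebraHom.comp g.property.isCoalgebraHom,
      by rw [← Category.assoc, f.property.inj_comp, g.property.inj_comp],
      by rw [Category.assoc, g.property.comp_proj, f.property.comp_proj]⟩
  id_comp _ := AdmissiblePair.Hom.ext (Category.id_comp _)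
  comp_id _ := AdmissiblePair.Hom.ext (Category.comp_id _)
  assoc _ _ _ := AdmissiblePair.Hom.ext (Category.assoc _ _ _)

/-- The assignment `H ⋉ (-)`, `X ↦ (H, X)`, `f ↦ id_H ⊗ f`, is well defined, i.e. its values are
admissible pairs and morphisms of admissible pairs. -/
structure CrossProductWellDefined (H : C) [BimonObj H] : Prop where
  obj (A : CrossedModuleBialgebra H) : A.data.IsAdmissible
  map {A B : CrossedModuleBialgebra H} (f : A ⟶ B) :
    CrossData.IsAdmissibleHom A.data B.data (H ◁ f.hom)

/-- The functor `H ⋉ (-)` from crossed module bialgebras to admissible pairs. -/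
def crossProduct (w : CrossProductWellDefined H) :
    CrossedModuleBialgebra H ⥤ AdmissiblePair H where
  obj A := ⟨A.data, w.obj A⟩
  map f := ⟨H ◁ f.hom, w.map f⟩
  map_id _ := AdmissiblePair.Hom.ext (whiskerLeft_id _ _)
  map_comp _ _ := AdmissiblePair.Hom.ext (MonoidalCategory.whiskerLeft_comp _ _ _)

end Categories

section Coinvariants

variable {H : C} [HopfObj H]

/-- The data of a bialgebra in the braided category of `H`-Hopf bimodules: the bimodule and
bicomodule structures on `B`, a splitting of the idempotent
`Π = leftAct ∘ (S ⊗ id) ∘ leftCoact` with image `ᴴB = splitting.Y`, and the structure morphisms,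
where `B ⊗_H B` is realized on `B ⊗ ᴴB` and the unit object is `H`. -/
structure HopfBimoduleBialgebraData (H : C) [HopfObj H] where
  B : C
  leftAct : H ⊗ B ⟶ B
  rightAct : B ⊗ H ⟶ B
  leftCoact : B ⟶ H ⊗ B
  rightCoact : B ⟶ B ⊗ H
  splitting : IdempotentSplitting (leftCoact ≫ 𝒮[H] ▷ B ≫ leftAct)
  mul : B ⊗ splitting.Y ⟶ B
  one : H ⟶ B
  comul : B ⟶ B ⊗ splitting.Y
  counit : B ⟶ H

/-- The functor of coinvariants from Hopf bimodules to crossed modules on the data of a bialgebra.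
The crossed module structure on `Y = ᴴB` is `p ∘ rightAct ∘ (i ⊗ id)`, `(p ⊗ id) ∘ rightCoact ∘ i`.
Coinvariants of `B ⊗ ᴴB` are split by `i ⊗ id`, `p ⊗ id`, and those of the unit object `H` are
`𝟙_ C`, split by the unit and the counit of `H`. -/
def HopfBimoduleBialgebraData.coinvariants (B : HopfBimoduleBialgebraData H) : CrossData H where
  X := B.splitting.Y
  mul := B.splitting.i ▷ B.splitting.Y ≫ B.mul ≫ B.splitting.p
  one := η[H] ≫ B.one ≫ B.splitting.p
  comul := B.splitting.i ≫ B.comul ≫ B.splitting.p ▷ B.splitting.Y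
  counit := B.splitting.i ≫ B.counit ≫ ε[H]
  act := B.splitting.i ▷ H ≫ B.rightAct ≫ B.splitting.p
  coact := B.splitting.i ≫ B.rightCoact ≫ B.splitting.p ▷ H

namespace AdmissiblePair

/-- The left action of `H` on `H ⋉ X`, by pullback along `j`. -/
def leftAct (A : AdmissiblePair H) : H ⊗ (H ⊗ A.data.X) ⟶ H ⊗ A.data.X :=
  A.data.inj ▷ (H ⊗ A.data.X) ≫ A.data.crossMul

/-- The right action of `H` on `H ⋉ X`, by pullback along `j`. -/
def rightAct (A : AdmissiblePair H) : (H ⊗ A.data.X) ⊗ H ⟶ H ⊗ A.data.X :=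
  (H ⊗ A.data.X) ◁ A.data.inj ≫ A.data.crossMul

/-- The left coaction of `H` on `H ⋉ X`, by pushout along `k`. -/
def leftCoact (A : AdmissiblePair H) : H ⊗ A.data.X ⟶ H ⊗ (H ⊗ A.data.X) :=
  A.data.crossComul ≫ A.data.proj ▷ (H ⊗ A.data.X)

/-- The right coaction of `H` on `H ⋉ X`, by pushout along `k`. -/
def rightCoact (A : AdmissiblePair H) : H ⊗ A.data.X ⟶ (H ⊗ A.data.X) ⊗ H :=
  A.data.crossComul ≫ (H ⊗ A.data.X) ◁ A.data.proj

/-- The idempotent `Π = leftAct ∘ (S ⊗ id) ∘ leftCoact` of the Hopf bimodule `H ⋉ X`. -/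
def idem (A : AdmissiblePair H) : H ⊗ A.data.X ⟶ H ⊗ A.data.X :=
  A.leftCoact ≫ 𝒮[H] ▷ (H ⊗ A.data.X) ≫ A.leftAct

/-- The functor `F` on objects: the bialgebra `H ⋉ X` with its projection on `H`, regarded as a
Hopf bimodule bialgebra with multiplication `m ∘ (id ⊗ i)`, unit `j`, comultiplication
`(id ⊗ p) ∘ Δ` and counit `k`. On morphisms `F` is the identity. -/
def toHopfBimoduleBialgebra (A : AdmissiblePair H) (s : IdempotentSplitting A.idem) :
    HopfBimoduleBialgebraData H where
  B := H ⊗ A.data.X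
  leftAct := A.leftAct
  rightAct := A.rightAct
  leftCoact := A.leftCoact
  rightCoact := A.rightCoact
  splitting := s
  mul := (H ⊗ A.data.X) ◁ s.i ≫ A.data.crossMul
  one := A.data.inj
  comul := A.data.crossComul ≫ (H ⊗ A.data.X) ◁ s.p
  counit := A.data.proj

theorem idem_natural {A B : AdmissiblePair H} (h : A ⟶ B) : A.idem ≫ h.hom = h.hom ≫ B.idem := by
  have h1 := h.property.isAlgebraHom.map_mul
  have h2 := h.property.isCoalgebraHom.map_comul
  have h3 := h.property.inj_comp
  have h4 := h.property.comp_proj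
  calc A.idem ≫ h.hom
      = A.data.crossComul ≫ A.data.proj ▷ (H ⊗ A.data.X) ≫ 𝒮[H] ▷ (H ⊗ A.data.X) ≫
          A.data.inj ▷ (H ⊗ A.data.X) ≫ (h.hom ⊗ₘ h.hom) ≫ B.data.crossMul := by
        simp only [idem, leftAct, leftCoact, Category.assoc, h1]
    _ = A.data.crossComul ≫ (h.hom ⊗ₘ h.hom) ≫ B.data.proj ▷ (H ⊗ B.data.X) ≫
          𝒮[H] ▷ (H ⊗ B.data.X) ≫ B.data.inj ▷ (H ⊗ B.data.X) ≫ B.data.crossMul := by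
        rw [← h3, ← h4]
        simp only [MonoidalCategory.tensorHom_def, comp_whiskerRight, Category.assoc,
          whisker_exchange_assoc]
    _ = h.hom ≫ B.idem := by
        simp only [idem, leftAct, leftCoact, Category.assoc, reassoc_of% h2]

/-- Splittings of the idempotents of all admissible pairs: the choice that the functor of
coinvariants depends on. -/
abbrev SplittingChoice (H : C) [HopfObj H] : Type (max u v) :=
  ∀ A : AdmissiblePair H, IdempotentSplitting A.idem

/-- The assignment `ᴴ(-) ∘ F` (for a choice of splittings) is well defined, i.e. its values are
crossed module bialgebras and morphisms of crossed module bialgebras. -/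
structure CoinvariantsWellDefined (σ : SplittingChoice H) : Prop where
  obj (A : AdmissiblePair H) :
    (A.toHopfBimoduleBialgebra (σ A)).coinvariants.IsCrossedModuleBialgebra
  map {A B : AdmissiblePair H} (h : A ⟶ B) :
    CrossData.IsCrossedModuleBialgebraHom (A.toHopfBimoduleBialgebra (σ A)).coinvariants
      (B.toHopfBimoduleBialgebra (σ B)).coinvariants ((σ A).i ≫ h.hom ≫ (σ B).p)

/-- The functor `ᴴ(-) ∘ F` from admissible pairs to crossed module bialgebras; a morphism `h` is
sent to `p ∘ h ∘ i`. -/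
def coinvariantsFunctor (σ : SplittingChoice H) (w : CoinvariantsWellDefined σ) :
    AdmissiblePair H ⥤ CrossedModuleBialgebra H where
  obj A := ⟨(A.toHopfBimoduleBialgebra (σ A)).coinvariants, w.obj A⟩
  map {A B} h := ⟨(σ A).i ≫ h.hom ≫ (σ B).p, w.map h⟩
  map_id A := CrossedModuleBialgebra.Hom.ext
    ((congrArg ((σ A).i ≫ ·) (Category.id_comp _)).trans (σ A).i_p)
  map_comp {A B D} f g := CrossedModuleBialgebra.Hom.ext <| by
    have h1 : (σ A).i ≫ f.hom ≫ (B.idem ≫ g.hom) ≫ (σ D).p =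
        (σ A).i ≫ f.hom ≫ g.hom ≫ (σ D).p := by
      rw [idem_natural g, Category.assoc, (σ D).e_p]
    have h2 := congrArg (fun t => (σ A).i ≫ f.hom ≫ (t ≫ g.hom) ≫ (σ D).p) (σ B).p_i
    change (σ A).i ≫ (f.hom ≫ g.hom) ≫ (σ D).p =
      ((σ A).i ≫ f.hom ≫ (σ B).p) ≫ (σ B).i ≫ g.hom ≫ (σ D).p
    simp only [Category.assoc] at h1 h2 ⊢
    exact (h2.trans h1).symm

theorem one_swap (A : AdmissiblePair H) :
    A.data.one ▷ H ≫ A.data.swap = (λ_ H).hom ≫ (ρ_ H).inv ≫ H ◁ A.data.one := by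
  have h : (unitAct H) ≫ A.data.one = A.data.one ▷ H ≫ A.data.act :=
    A.property.isModuleAlgebra.one_hom
  have h2 := ComonObj.comul_counit H
  calc A.data.one ▷ H ≫ A.data.swap
      = (𝟙_ C) ◁ Δ[H] ≫ (α_ (𝟙_ C) H H).inv ≫ (β_ (𝟙_ C) H).hom ▷ H ≫ (α_ H (𝟙_ C) H).hom ≫
          H ◁ (A.data.one ▷ H ≫ A.data.act) := by
        simp only [CrossData.swap, MonoidalCategory.whiskerLeft_comp]
        rw [← whisker_exchange_assoc, associator_inv_naturality_left_assoc,
          ← comp_whiskerRight_assoc, BraidedCategory.braiding_naturality_left,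
          comp_whiskerRight_assoc, associator_naturality_middle_assoc]
    _ = (λ_ H).hom ≫ (Δ[H] ≫ H ◁ ε[H]) ≫ H ◁ A.data.one := by
        rw [← h, unitAct, braiding_tensorUnit_left]
        simp
    _ = _ := by rw [h2]

theorem coswap_counit (A : AdmissiblePair H) :
    A.data.coswap ≫ A.data.counit ▷ H = H ◁ A.data.counit ≫ (ρ_ H).hom ≫ (λ_ H).inv := by
  have h : A.data.counit ≫ unitCoact H = A.data.coact ≫ A.data.counit ▷ H :=
    A.property.isComoduleCoalgebra.counit_hom
  have h2 := MonObj.mul_one H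
  calc A.data.coswap ≫ A.data.counit ▷ H
      = H ◁ (A.data.coact ≫ A.data.counit ▷ H) ≫ (α_ H (𝟙_ C) H).inv ≫
          (β_ H (𝟙_ C)).hom ▷ H ≫ (α_ (𝟙_ C) H H).hom ≫ (𝟙_ C) ◁ μ[H] := by
        simp only [CrossData.coswap, MonoidalCategory.whiskerLeft_comp, Category.assoc]
        rw [whisker_exchange, ← associator_naturality_left_assoc,
          ← comp_whiskerRight_assoc, ← BraidedCategory.braiding_naturality_right,
          comp_whiskerRight_assoc, associator_inv_naturality_middle_assoc]
    _ = H ◁ A.data.counit ≫ (H ◁ η[H] ≫ μ[H]) ≫ (λ_ H).inv := by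
        rw [← h, unitCoact, braiding_tensorUnit_right]
        simp only [MonoidalCategory.whiskerLeft_comp, Category.assoc]
        monoidal
    _ = _ := by rw [h2]

theorem leftAct_eq (A : AdmissiblePair H) :
    A.leftAct = (α_ H H A.data.X).inv ≫ μ[H] ▷ A.data.X := by
  have h1 : A.data.one ▷ A.data.X ≫ A.data.mul = (λ_ A.data.X).hom := by
    obtain ⟨s, hs, hs'⟩ := A.property.isModuleAlgebra.isAlgebra
    rw [← hs, ← hs']
    exact s.one_mul
  have h2 := congrArg (· ▷ A.data.X) (one_swap A)
  simp only [comp_whiskerRight] at h2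
  calc A.leftAct
      = (ρ_ H).inv ▷ (H ⊗ A.data.X) ≫ (α_ H (𝟙_ C) (H ⊗ A.data.X)).hom ≫
          H ◁ ((α_ (𝟙_ C) H A.data.X).inv ≫
            (A.data.one ▷ H ▷ A.data.X ≫ A.data.swap ▷ A.data.X) ≫
            (α_ H A.data.X A.data.X).hom) ≫
          (α_ H H (A.data.X ⊗ A.data.X)).inv ≫ (μ[H] ⊗ₘ A.data.mul) := by
        simp only [leftAct, CrossData.inj, CrossData.crossMul, Category.assoc]
        monoidal
    _ = (ρ_ H).inv ▷ (H ⊗ A.data.X) ≫ (α_ H (𝟙_ C) (H ⊗ A.data.X)).hom ≫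
          H ◁ ((α_ (𝟙_ C) H A.data.X).inv ≫
            ((λ_ H).hom ▷ A.data.X ≫ (ρ_ H).inv ▷ A.data.X) ≫
            (α_ H (𝟙_ C) A.data.X).hom) ≫
          (α_ H H (𝟙_ C ⊗ A.data.X)).inv ≫
            (H ⊗ H) ◁ (A.data.one ▷ A.data.X ≫ A.data.mul) ≫ μ[H] ▷ A.data.X := by
        rw [h2, MonoidalCategory.tensorHom_def']
        monoidal
    _ = _ := by
        rw [h1]
        monoidal

theorem leftCoact_eq (A : AdmissiblePair H) :
    A.leftCoact = Δ[H] ▷ A.data.X ≫ (α_ H H A.data.X).hom := by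
  have h1 : A.data.comul ≫ A.data.counit ▷ A.data.X = (λ_ A.data.X).inv := by
    obtain ⟨s, hs, hs'⟩ := A.property.isComoduleCoalgebra.isCoalgebra
    rw [← hs, ← hs']
    exact s.counit_comul
  have h2 := congrArg (· ▷ A.data.X) (coswap_counit A)
  simp only [comp_whiskerRight] at h2
  calc A.leftCoact
      = (Δ[H] ⊗ₘ A.data.comul) ≫ (α_ H H (A.data.X ⊗ A.data.X)).hom ≫
          H ◁ ((α_ H A.data.X A.data.X).inv ≫
            (A.data.coswap ▷ A.data.X ≫ A.data.counit ▷ H ▷ A.data.X) ≫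
            (α_ (𝟙_ C) H A.data.X).hom) ≫ (α_ H (𝟙_ C) (H ⊗ A.data.X)).inv ≫
          (ρ_ H).hom ▷ (H ⊗ A.data.X) := by
        simp only [leftCoact, CrossData.proj, CrossData.crossComul, Category.assoc]
        monoidal
    _ = Δ[H] ▷ A.data.X ≫ (H ⊗ H) ◁ (A.data.comul ≫ A.data.counit ▷ A.data.X) ≫
          (α_ H H (𝟙_ C ⊗ A.data.X)).hom ≫
          H ◁ ((α_ H (𝟙_ C) A.data.X).inv ≫
            ((ρ_ H).hom ▷ A.data.X ≫ (λ_ H).inv ▷ A.data.X) ≫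
            (α_ (𝟙_ C) H A.data.X).hom) ≫ (α_ H (𝟙_ C) (H ⊗ A.data.X)).inv ≫
          (ρ_ H).hom ▷ (H ⊗ A.data.X) := by
        rw [h2, MonoidalCategory.tensorHom_def]
        monoidal
    _ = _ := by
        rw [h1]
        monoidal

/-- The canonical splitting of the idempotent of `H ⋉ X`, with image `X` itself,
`i = η_H ⊗ id_X` and `p = ε_H ⊗ id_X`. -/
def canonicalSplitting : SplittingChoice H := fun A =>
  { Y := A.data.X
    i := (λ_ A.data.X).inv ≫ η[H] ▷ A.data.X
    p := ε[H] ▷ A.data.X ≫ (λ_ A.data.X).hom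
    i_p := by
      simp [← comp_whiskerRight_assoc]
    p_i := by
      have h1 := congrArg (· ▷ A.data.X) (HopfObj.antipode_left H)
      simp only [comp_whiskerRight] at h1
      simp only [idem, leftAct_eq, leftCoact_eq, Category.assoc]
      simp [h1] }

end AdmissiblePair

end Coinvariants

end BraidedCross

/-!
Write `B = H ⋉ X`, with the inclusions `inj` of `H` and `inr` of `X` and the projections `proj`
and `projX`. The cross product algebra is a tensor product twisted by a distributive law
(`IsDistributiveLaw`), namely `swap : x ⊗ h ↦ h₍₁₎ ⊗ x · h₍₂₎`: its axioms hold because `X` is an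
`H`-module with `H`-linear multiplication and unit (`IsModuleAlgebra.isDistributiveLaw`). A
twisted tensor product has a universal property (`IsAlgebraHom.twist`): an algebra morphism on it
is a pair of algebra morphisms on the two factors whose images commute up to the distributive law.
The cross coproduct is the same construction in `Cᵒᵖ`, where `H` is again a bialgebra
(`opBimonObj`) and `X` becomes data of the same kind (`CrossData.op`), so that its properties
follow from those of the cross product.

From crossed module bialgebras to admissible pairs, the point is that the comultiplication of `B`
is an algebra morphism `B ⟶ B ⊗ B` (`IsCrossedModuleBialgebra.isAlgebraHom_crossComul`). By the
universal property it is enough to consider it on `H` and on `X`. On `X` it is the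
comultiplication of `X`, which is an algebra morphism to `X ⊗ X` twisted by the braiding of
crossed modules, followed by `x ⊗ y ↦ (x₍₀₎ ⊗ x₍₁₎)(1 ⊗ y)`, which is an algebra morphism by the
universal property again (`inSnd_commute_coact`). That the images of `H` and `X` commute up to
`swap` follows from the crossed module condition (`comul_commute_coact`, `comul_commute_inSnd`)
and from the `H`-linearity of the comultiplication of `X`.

Conversely, for an admissible pair the equation between `Δ ∘ m` and `(m ⊗ m) ∘ (Δ ⊗ Δ)` on
`B ⊗ B`, restricted to `X ⊗ H` or `X ⊗ X` and projected on `X ⊗ H` or `X ⊗ X`, gives the crossed module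
condition, the linearity of the comultiplication of `X` and the bialgebra condition in the
category of crossed modules (`IsAdmissible.inr_mul_comul_projX` and the theorems after it). The
remaining conditions follow by duality.

A morphism of admissible pairs commutes with the idempotents `Π`, whose image is `X`, and
therefore has the form `id_H ⊗ f` (`hom_eq_whiskerLeft`), with `f` a morphism of crossed module
bialgebras. For any splitting, `i` followed by `projX` identifies the coinvariants with `X`
compatibly with all structure morphisms (`isCrossedModuleBialgebraHom_coinvariants`). Hence the
coinvariants form a crossed module bialgebra (`IsCrossedModuleBialgebra.of_isIso`), which is equal
to `X` for the canonical splitting and naturally isomorphic to it for any other.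
-/

namespace BraidedCross

/-! ### Distributive laws and twisted tensor products of algebras -/

section DistributiveLaw

variable {C : Type u} [Category.{v} C] [MonoidalCategory.{v} C]
variable {A B : C}

/-- The multiplication `(m_A ⊗ m_B) ∘ (id ⊗ s ⊗ id)` on `A ⊗ B` twisted by `s : B ⊗ A ⟶ A ⊗ B`. -/
def twistMul (mA : A ⊗ A ⟶ A) (mB : B ⊗ B ⟶ B) (s : B ⊗ A ⟶ A ⊗ B) :
    (A ⊗ B) ⊗ (A ⊗ B) ⟶ A ⊗ B :=
  (α_ A B (A ⊗ B)).hom ≫ A ◁ ((α_ B A B).inv ≫ s ▷ B ≫ (α_ A B B).hom) ≫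
    (α_ A A (B ⊗ B)).inv ≫ (mA ⊗ₘ mB)

theorem twistMul_natural {A B A' B' : C} {mA : A ⊗ A ⟶ A} {mB : B ⊗ B ⟶ B} {mA' : A' ⊗ A' ⟶ A'}
    {mB' : B' ⊗ B' ⟶ B'} {s : B ⊗ A ⟶ A ⊗ B} {s' : B' ⊗ A' ⟶ A' ⊗ B'} {f : A ⟶ A'} {g : B ⟶ B'}
    (hf : mA ≫ f = (f ⊗ₘ f) ≫ mA') (hg : mB ≫ g = (g ⊗ₘ g) ≫ mB')
    (hs : s ≫ (f ⊗ₘ g) = (g ⊗ₘ f) ≫ s') :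
    twistMul mA mB s ≫ (f ⊗ₘ g) = ((f ⊗ₘ g) ⊗ₘ (f ⊗ₘ g)) ≫ twistMul mA' mB' s' := by
  have h1 : A ◁ s ▷ B ≫ (f ⊗ₘ ((f ⊗ₘ g) ⊗ₘ g)) = (f ⊗ₘ ((g ⊗ₘ f) ⊗ₘ g)) ≫ A' ◁ s' ▷ B' := by
    rw [← id_tensorHom, ← tensorHom_id, ← id_tensorHom, ← tensorHom_id, tensorHom_comp_tensorHom,
      tensorHom_comp_tensorHom, tensorHom_comp_tensorHom, tensorHom_comp_tensorHom, hs]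
    simp
  calc _ = 𝟙 _ ⊗≫ A ◁ s ▷ B ⊗≫ ((mA ≫ f) ⊗ₘ (mB ≫ g)) := by
        rw [← tensorHom_comp_tensorHom, twistMul]; monoidal
    _ = 𝟙 _ ⊗≫ (A ◁ s ▷ B ≫ (f ⊗ₘ ((f ⊗ₘ g) ⊗ₘ g))) ⊗≫ (mA' ⊗ₘ mB') := by
        rw [hf, hg, ← tensorHom_comp_tensorHom]; monoidal
    _ = _ := by
        rw [h1, twistMul]; monoidal

/-- `s : B ⊗ A ⟶ A ⊗ B` is a distributive law between the multiplications and units of `A` and `B`: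
it is compatible with both units and both multiplications. `A` and `B` are not assumed to be
algebras here. -/
structure IsDistributiveLaw (mA : A ⊗ A ⟶ A) (eA : 𝟙_ C ⟶ A) (mB : B ⊗ B ⟶ B) (eB : 𝟙_ C ⟶ B)
    (s : B ⊗ A ⟶ A ⊗ B) : Prop where
  one_left : eB ▷ A ≫ s = (λ_ A).hom ≫ (ρ_ A).inv ≫ A ◁ eB
  one_right : B ◁ eA ≫ s = (ρ_ B).hom ≫ (λ_ B).inv ≫ eA ▷ B
  mul_left : mB ▷ A ≫ s = (α_ B B A).hom ≫ B ◁ s ≫ (α_ B A B).inv ≫ s ▷ B ≫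
    (α_ A B B).hom ≫ A ◁ mB
  mul_right : B ◁ mA ≫ s = (α_ B A A).inv ≫ s ▷ A ≫ (α_ A B A).hom ≫ A ◁ s ≫
    (α_ A A B).inv ≫ mA ▷ B

/-- A distributive law between two algebras makes their tensor product an algebra. -/
theorem IsDistributiveLaw.isAlgebra {mA : A ⊗ A ⟶ A} {eA : 𝟙_ C ⟶ A} {mB : B ⊗ B ⟶ B}
    {eB : 𝟙_ C ⟶ B} {s : B ⊗ A ⟶ A ⊗ B} (hs : IsDistributiveLaw mA eA mB eB s)
    (hA : IsAlgebra mA eA) (hB : IsAlgebra mB eB) :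
    IsAlgebra (twistMul mA mB s) ((λ_ (𝟙_ C)).inv ≫ (eA ⊗ₘ eB)) := by
  obtain ⟨sA, rfl, rfl⟩ := hA
  obtain ⟨sB, rfl, rfl⟩ := hB
  refine ⟨{ mul := twistMul μ μ s, one := (λ_ (𝟙_ C)).inv ≫ (η ⊗ₘ η), one_mul := ?_,
            mul_one := ?_, mul_assoc := ?_ }, rfl, rfl⟩
  · calc _ = 𝟙 _ ⊗≫ η[A] ▷ (A ⊗ B) ⊗≫ A ◁ (η[B] ▷ A ≫ s) ▷ B ⊗≫ A ◁ A ◁ μ[B] ⊗≫ μ[A] ▷ B := by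
          rw [twistMul, MonoidalCategory.tensorHom_def, MonoidalCategory.tensorHom_def']; monoidal
      _ = 𝟙 _ ⊗≫ η[A] ▷ (A ⊗ B) ⊗≫ A ◁ A ◁ (η[B] ▷ B ≫ μ[B]) ⊗≫ μ[A] ▷ B := by
          rw [hs.one_left]; monoidal
      _ = 𝟙 _ ⊗≫ (η[A] ▷ A ≫ μ[A]) ▷ B := by
          rw [MonObj.one_mul]; monoidal
      _ = _ := by
          rw [MonObj.one_mul]; monoidal
  · calc _ = 𝟙 _ ⊗≫ A ◁ B ◁ η[B] ⊗≫ A ◁ (B ◁ η[A] ≫ s) ▷ B ⊗≫ A ◁ A ◁ μ[B] ⊗≫ μ[A] ▷ B := by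
          simp only [twistMul, MonoidalCategory.tensorHom_def']; monoidal
      _ = 𝟙 _ ⊗≫ A ◁ B ◁ η[B] ⊗≫ A ◁ (η[A] ▷ (B ⊗ B) ≫ A ◁ μ[B]) ⊗≫ μ[A] ▷ B := by
          rw [hs.one_right]; monoidal
      _ = 𝟙 _ ⊗≫ A ◁ (B ◁ η[B] ≫ μ[B]) ⊗≫ (A ◁ η[A] ≫ μ[A]) ▷ B := by
          rw [← whisker_exchange]; monoidal
      _ = _ := by
          rw [MonObj.mul_one, MonObj.mul_one]; monoidal
  · calc _ = 𝟙 _ ⊗≫ A ◁ s ▷ B ▷ A ▷ B ⊗≫ A ◁ A ◁ μ[B] ▷ A ▷ B ⊗≫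
            (μ[A] ▷ ((B ⊗ A) ⊗ B) ≫ A ◁ (s ▷ B ⊗≫ A ◁ μ[B])) ⊗≫ μ[A] ▷ B := by
          rw [twistMul, MonoidalCategory.tensorHom_def']; monoidal
      _ = 𝟙 _ ⊗≫ A ◁ s ▷ B ▷ A ▷ B ⊗≫ A ◁ A ◁ (μ[B] ▷ A ≫ s) ▷ B ⊗≫ A ◁ A ◁ A ◁ μ[B] ⊗≫
            (μ[A] ▷ A ≫ μ[A]) ▷ B := by
          rw [← whisker_exchange]; monoidal
      _ = 𝟙 _ ⊗≫ A ◁ (s ▷ ((B ⊗ A) ⊗ B) ≫ (A ⊗ B) ◁ (s ▷ B)) ⊗≫ A ◁ A ◁ s ▷ B ▷ B ⊗≫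
            A ◁ A ◁ A ◁ (μ[B] ▷ B ≫ μ[B]) ⊗≫ (μ[A] ▷ A ≫ μ[A]) ▷ B := by
          rw [hs.mul_left]; monoidal
      _ = 𝟙 _ ⊗≫ A ◁ B ◁ A ◁ s ▷ B ⊗≫ A ◁ s ▷ A ▷ B ▷ B ⊗≫ A ◁ A ◁ s ▷ B ▷ B ⊗≫
            A ◁ ((A ⊗ A) ◁ (B ◁ μ[B] ≫ μ[B]) ≫ μ[A] ▷ B) ⊗≫ μ[A] ▷ B := by
          rw [← whisker_exchange, MonObj.mul_assoc, MonObj.mul_assoc]; monoidal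
      _ = 𝟙 _ ⊗≫ A ◁ B ◁ A ◁ s ▷ B ⊗≫ A ◁ ((α_ B A A).inv ≫ s ▷ A ≫ (α_ A B A).hom ≫ A ◁ s ≫
            (α_ A A B).inv ≫ μ[A] ▷ B) ▷ B ▷ B ⊗≫
            A ◁ A ◁ (B ◁ μ[B] ≫ μ[B]) ⊗≫ μ[A] ▷ B := by
          rw [whisker_exchange]; monoidal
      _ = 𝟙 _ ⊗≫ A ◁ B ◁ A ◁ s ▷ B ⊗≫ A ◁ ((B ◁ μ[A] ≫ s) ▷ (B ⊗ B) ≫ (A ⊗ B) ◁ μ[B]) ⊗≫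
            A ◁ A ◁ μ[B] ⊗≫ μ[A] ▷ B := by
          rw [← hs.mul_right]; monoidal
      _ = _ := by
          rw [← whisker_exchange, twistMul, MonoidalCategory.tensorHom_def']; monoidal

/-- Universal property of the twisted tensor product: algebra morphisms `f` and `g` whose images
commute up to `s` combine to an algebra morphism `a ⊗ b ↦ f(a) g(b)` (no distributive law is needed
for this direction). -/
theorem IsAlgebraHom.twist {mA : A ⊗ A ⟶ A} {eA : 𝟙_ C ⟶ A} {mB : B ⊗ B ⟶ B}
    {eB : 𝟙_ C ⟶ B} {s : B ⊗ A ⟶ A ⊗ B} {T : C} [MonObj T] {f : A ⟶ T} {g : B ⟶ T}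
    (hf : IsAlgebraHom mA eA μ[T] η[T] f) (hg : IsAlgebraHom mB eB μ[T] η[T] g)
    (hs : (g ⊗ₘ f) ≫ μ[T] = s ≫ (f ⊗ₘ g) ≫ μ[T]) :
    IsAlgebraHom (twistMul mA mB s) ((λ_ (𝟙_ C)).inv ≫ (eA ⊗ₘ eB)) μ[T] η[T]
      ((f ⊗ₘ g) ≫ μ[T]) where
  map_one := by
    rw [Category.assoc, tensorHom_comp_tensorHom_assoc, hf.map_one, hg.map_one,
      MonoidalCategory.tensorHom_def_assoc, MonObj.mul_one]
    monoidal
  map_mul := by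
    have h (Z : C) (x : Z ⟶ T ⊗ T) :
        f ⊗ₘ (x ≫ μ[T]) ⊗ₘ g = (f ⊗ₘ (x ⊗ₘ g)) ≫ T ◁ μ[T] ▷ T := by
      rw [← tensorHom_id, ← id_tensorHom, tensorHom_comp_tensorHom, tensorHom_comp_tensorHom]
      simp
    calc _ = 𝟙 _ ⊗≫ A ◁ s ▷ B ⊗≫ ((mA ⊗ₘ mB) ≫ (f ⊗ₘ g)) ⊗≫ μ[T] := by
          rw [twistMul]; monoidal
      _ = 𝟙 _ ⊗≫ A ◁ s ▷ B ⊗≫ (((f ⊗ₘ f) ≫ μ[T]) ⊗ₘ ((g ⊗ₘ g) ≫ μ[T])) ⊗≫ μ[T] := by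
          rw [tensorHom_comp_tensorHom, hf.map_mul, hg.map_mul]
      _ = 𝟙 _ ⊗≫ A ◁ s ▷ B ⊗≫ ((f ⊗ₘ f) ⊗ₘ (g ⊗ₘ g)) ⊗≫
            ((T ⊗ T) ◁ μ[T] ≫ μ[T] ▷ T ≫ μ[T]) := by
          rw [← tensorHom_comp_tensorHom, MonoidalCategory.tensorHom_def' μ[T]]; monoidal
      _ = 𝟙 _ ⊗≫ ((𝟙 A ⊗ₘ (s ⊗ₘ 𝟙 B)) ≫ (f ⊗ₘ ((f ⊗ₘ g) ⊗ₘ g))) ⊗≫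
            T ◁ (μ[T] ▷ T ≫ μ[T]) ⊗≫ μ[T] := by
          rw [MonObj.mul_assoc, MonObj.mul_assoc_flip, id_tensorHom, tensorHom_id]
          simp
          monoidal
      _ = 𝟙 _ ⊗≫ (f ⊗ₘ (s ≫ (f ⊗ₘ g) ≫ μ[T]) ⊗ₘ g) ⊗≫ T ◁ μ[T] ⊗≫ μ[T] := by
          rw [tensorHom_comp_tensorHom, tensorHom_comp_tensorHom, Category.id_comp,
            Category.id_comp, ← Category.assoc s, h]
          monoidal
      _ = 𝟙 _ ⊗≫ ((f ⊗ₘ g) ⊗ₘ (f ⊗ₘ g)) ⊗≫ T ◁ (T ◁ μ[T] ≫ μ[T]) ⊗≫ μ[T] := by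
          rw [← hs, h, MonObj.mul_assoc_flip]
          simp [-MonObj.mul_assoc, -MonObj.mul_assoc_assoc]
          monoidal
      _ = 𝟙 _ ⊗≫ ((f ⊗ₘ g) ⊗ₘ (f ⊗ₘ g)) ⊗≫ ((T ⊗ T) ◁ μ[T] ≫ μ[T] ▷ T ≫ μ[T]) := by
          rw [MonObj.mul_assoc]; monoidal
      _ = _ := by
          rw [← tensorHom_comp_tensorHom, MonoidalCategory.tensorHom_def' μ[T]]; monoidal

end DistributiveLaw

/-! ### The morphism that exchanges the tensor factors of the cross product -/

section Swap

variable {C : Type u} [Category.{v} C] [MonoidalCategory.{v} C] [BraidedCategory C]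
variable {H V W : C}

/-- The morphism `v ⊗ h ↦ h₍₁₎ ⊗ v · h₍₂₎` (with the braiding) for an arbitrary `d : H ⟶ H ⊗ H`
and an arbitrary `a : V ⊗ H ⟶ V`. For the comultiplication and the action of `X` it is
`CrossData.swap`. -/
def swapMap (d : H ⟶ H ⊗ H) (a : V ⊗ H ⟶ V) : V ⊗ H ⟶ H ⊗ V :=
  V ◁ d ≫ (α_ V H H).inv ≫ (β_ V H).hom ▷ H ≫ (α_ H V H).hom ≫ H ◁ a

theorem swapMap_natural (d : H ⟶ H ⊗ H) {a : V ⊗ H ⟶ V} {b : W ⊗ H ⟶ W} {f : V ⟶ W}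
    (hf : IsModuleHom a b f) : f ▷ H ≫ swapMap d b = swapMap d a ≫ H ◁ f := by
  unfold IsModuleHom at hf
  calc _ = 𝟙 _ ⊗≫ (f ▷ H ≫ W ◁ d) ⊗≫ (β_ W H).hom ▷ H ⊗≫ H ◁ b := by
        rw [swapMap]; monoidal
    _ = 𝟙 _ ⊗≫ V ◁ d ⊗≫ (f ▷ H ≫ (β_ W H).hom) ▷ H ⊗≫ H ◁ b := by
        rw [← whisker_exchange]; monoidal
    _ = 𝟙 _ ⊗≫ V ◁ d ⊗≫ (β_ V H).hom ▷ H ⊗≫ H ◁ (f ▷ H ≫ b) := by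
        rw [BraidedCategory.braiding_naturality_left]; monoidal
    _ = _ := by
        rw [← hf, swapMap]; monoidal

theorem swapMap_unit {d : H ⟶ H ⊗ H} {c : H ⟶ 𝟙_ C} (hd : d ≫ H ◁ c = (ρ_ H).inv) :
    swapMap (V := 𝟙_ C) d ((λ_ H).hom ≫ c) = (λ_ H).hom ≫ (ρ_ H).inv := by
  calc _ = (λ_ H).hom ≫ d ≫ H ◁ c := by
        rw [swapMap, braiding_tensorUnit_left]; monoidal
    _ = _ := by rw [hd]

theorem swapMap_mul {m : H ⊗ H ⟶ H} {d : H ⟶ H ⊗ H} {a : V ⊗ H ⟶ V}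
    (hm : m ≫ d = (d ⊗ₘ d) ≫ tensorμ H H H H ≫ (m ⊗ₘ m))
    (ha : V ◁ m ≫ a = (α_ V H H).inv ≫ a ▷ H ≫ a) :
    V ◁ m ≫ swapMap d a = (α_ V H H).inv ≫ swapMap d a ▷ H ≫ (α_ H V H).hom ≫
      H ◁ swapMap d a ≫ (α_ H H V).inv ≫ m ▷ V := by
  calc _ = 𝟙 _ ⊗≫ V ◁ (m ≫ d) ⊗≫ (β_ V H).hom ▷ H ⊗≫ H ◁ a := by
        rw [swapMap]; monoidal
    _ = 𝟙 _ ⊗≫ V ◁ (d ⊗ₘ d) ⊗≫ V ◁ H ◁ (β_ H H).hom ▷ H ⊗≫ V ◁ (H ⊗ H) ◁ m ⊗≫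
          (V ◁ m ≫ (β_ V H).hom) ▷ H ⊗≫ H ◁ a := by
        rw [hm, tensorμ, MonoidalCategory.tensorHom_def' m]; monoidal
    _ = 𝟙 _ ⊗≫ V ◁ (d ⊗ₘ d) ⊗≫ V ◁ H ◁ (β_ H H).hom ▷ H ⊗≫
          ((V ⊗ (H ⊗ H)) ◁ m ≫ (β_ V (H ⊗ H)).hom ▷ H) ⊗≫ m ▷ V ▷ H ⊗≫ H ◁ a := by
        rw [BraidedCategory.braiding_naturality_right]; monoidal
    _ = 𝟙 _ ⊗≫ V ◁ (d ⊗ₘ d) ⊗≫ V ◁ H ◁ (β_ H H).hom ▷ H ⊗≫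
          (β_ V (H ⊗ H)).hom ▷ (H ⊗ H) ⊗≫ (H ⊗ H) ◁ V ◁ m ⊗≫ (m ▷ (V ⊗ H) ≫ H ◁ a) := by
        rw [whisker_exchange]; monoidal
    _ = 𝟙 _ ⊗≫ V ◁ (d ⊗ₘ d) ⊗≫ V ◁ H ◁ (β_ H H).hom ▷ H ⊗≫
          (β_ V (H ⊗ H)).hom ▷ (H ⊗ H) ⊗≫ (H ⊗ H) ◁ (V ◁ m ≫ a) ⊗≫ m ▷ V := by
        rw [← whisker_exchange]; monoidal
    _ = 𝟙 _ ⊗≫ V ◁ (d ⊗ₘ d) ⊗≫ ((V ⊗ H) ◁ (β_ H H).hom ≫ (β_ V H).hom ▷ (H ⊗ H)) ▷ H ⊗≫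
          H ◁ (β_ V H).hom ▷ H ▷ H ⊗≫ (H ⊗ H) ◁ (a ▷ H ≫ a) ⊗≫ m ▷ V := by
        rw [ha, BraidedCategory.braiding_tensor_right_hom]; monoidal
    _ = 𝟙 _ ⊗≫ V ◁ (d ⊗ₘ d) ⊗≫ (β_ V H).hom ▷ H ▷ H ▷ H ⊗≫ H ◁ ((β_ (V ⊗ H) H).hom ≫
          H ◁ a) ▷ H ⊗≫ (H ⊗ H) ◁ a ⊗≫ m ▷ V := by
        rw [whisker_exchange, BraidedCategory.braiding_tensor_left_hom]; monoidal
    _ = 𝟙 _ ⊗≫ V ◁ d ▷ H ⊗≫ ((V ⊗ (H ⊗ H)) ◁ d ≫ ((α_ V H H).inv ≫ (β_ V H).hom ▷ H ⊗≫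
          H ◁ a) ▷ (H ⊗ H)) ⊗≫ H ◁ (β_ V H).hom ▷ H ⊗≫ (H ⊗ H) ◁ a ⊗≫ m ▷ V := by
        rw [← BraidedCategory.braiding_naturality_left, MonoidalCategory.tensorHom_def d]; monoidal
    _ = _ := by
        rw [whisker_exchange, swapMap]; monoidal

theorem swapMap_one {e : 𝟙_ C ⟶ H} {d : H ⟶ H ⊗ H} {a : V ⊗ H ⟶ V}
    (he : e ≫ d = (λ_ (𝟙_ C)).inv ≫ (e ⊗ₘ e)) (ha : V ◁ e ≫ a = (ρ_ V).hom) :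
    V ◁ e ≫ swapMap d a = (ρ_ V).hom ≫ (λ_ V).inv ≫ e ▷ V := by
  calc _ = 𝟙 _ ⊗≫ V ◁ (e ≫ d) ⊗≫ (β_ V H).hom ▷ H ⊗≫ H ◁ a := by
        rw [swapMap]; monoidal
    _ = 𝟙 _ ⊗≫ ((V ⊗ 𝟙_ C) ◁ e ≫ ((V ◁ e) ≫ (β_ V H).hom) ▷ H) ⊗≫ H ◁ a := by
        rw [he, MonoidalCategory.tensorHom_def']; monoidal
    _ = 𝟙 _ ⊗≫ (β_ V (𝟙_ C)).hom ⊗≫ e ▷ V ⊗≫ H ◁ (V ◁ e ≫ a) := by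
        rw [whisker_exchange, BraidedCategory.braiding_naturality_right]; monoidal
    _ = _ := by
        rw [ha, braiding_tensorUnit_right]; monoidal

theorem swapMap_diagAct [ComonObj H] (a : V ⊗ H ⟶ V) (b : W ⊗ H ⟶ W) :
    swapMap Δ[H] (diagAct a b) = (α_ V W H).hom ≫ V ◁ swapMap Δ[H] b ≫ (α_ V H W).inv ≫
      swapMap Δ[H] a ▷ W ≫ (α_ H V W).hom := by
  symm
  calc _ = 𝟙 _ ⊗≫ V ◁ W ◁ Δ[H] ⊗≫ V ◁ (β_ W H).hom ▷ H ⊗≫ ((V ⊗ H) ◁ b ≫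
          (V ◁ Δ[H] ⊗≫ (β_ V H).hom ▷ H ⊗≫ H ◁ a) ▷ W) ⊗≫ 𝟙 _ := by
        simp only [swapMap]; monoidal
    _ = 𝟙 _ ⊗≫ V ◁ W ◁ Δ[H] ⊗≫ V ◁ ((β_ W H).hom ≫ Δ[H] ▷ W) ▷ H ⊗≫ (β_ V H).hom ▷ H ▷ W ▷ H ⊗≫
          H ◁ (a ▷ (W ⊗ H) ≫ V ◁ b) ⊗≫ 𝟙 _ := by
        rw [whisker_exchange]; monoidal
    _ = 𝟙 _ ⊗≫ V ◁ W ◁ (Δ[H] ≫ Δ[H] ▷ H) ⊗≫ V ◁ (β_ W H).hom ▷ H ▷ H ⊗≫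
          ((V ⊗ H) ◁ (β_ W H).hom ≫ (β_ V H).hom ▷ (H ⊗ W)) ▷ H ⊗≫
          H ◁ (a ⊗ₘ b) ⊗≫ 𝟙 _ := by
        rw [← BraidedCategory.braiding_naturality_right,
          BraidedCategory.braiding_tensor_right_hom, MonoidalCategory.tensorHom_def]; monoidal
    _ = 𝟙 _ ⊗≫ (V ⊗ W) ◁ Δ[H] ⊗≫ (((V ⊗ W) ⊗ H) ◁ Δ[H] ≫ (β_ (V ⊗ W) H).hom ▷ (H ⊗ H)) ⊗≫
          H ◁ V ◁ (β_ W H).hom ▷ H ⊗≫ H ◁ (a ⊗ₘ b) ⊗≫ 𝟙 _ := by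
        rw [whisker_exchange, BraidedCategory.braiding_tensor_left_hom, ComonObj.comul_assoc_flip]
        monoidal
    _ = _ := by
        rw [whisker_exchange, swapMap, diagAct, tensorμ]; monoidal

end Swap

/-! ### Duality -/

section Duality

open Opposite
variable {C : Type u} [Category.{v} C] [MonoidalCategory.{v} C]

theorem IsAlgebra.unop {A : C} {d : A ⟶ A ⊗ A} {c : A ⟶ 𝟙_ C}
    (h : IsAlgebra (C := Cᵒᵖ) (A := op A) d.op c.op) : IsCoalgebra d c := by
  obtain ⟨s, hm, he⟩ := h
  have h1 : (d.op : op A ⊗ op A ⟶ op A) = s.mul := hm.symm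
  have h2 : (c.op : 𝟙_ Cᵒᵖ ⟶ op A) = s.one := he.symm
  refine ⟨{ comul := d, counit := c, counit_comul := Quiver.Hom.op_inj ?_,
            comul_counit := Quiver.Hom.op_inj ?_, comul_assoc := Quiver.Hom.op_inj ?_ }, rfl, rfl⟩
  · have := s.one_mul
    rw [← h1, ← h2] at this
    simpa using this
  · have := s.mul_one
    rw [← h1, ← h2] at this
    simpa using this
  · have := s.mul_assoc
    rw [← h1] at this
    simp [this]

theorem IsCoalgebra.op {A : C} {d : A ⟶ A ⊗ A} {c : A ⟶ 𝟙_ C} (h : IsCoalgebra d c) :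
    IsAlgebra (C := Cᵒᵖ) (A := op A) d.op c.op := by
  obtain ⟨s, rfl, rfl⟩ := h
  exact ⟨Comon.ComonToMonOpOpObjMon ⟨A⟩, rfl, rfl⟩

theorem IsAlgebra.op {A : C} {m : A ⊗ A ⟶ A} {e : 𝟙_ C ⟶ A} (h : IsAlgebra m e) :
    IsCoalgebra (C := Cᵒᵖ) (A := op A) m.op e.op := by
  obtain ⟨s, rfl, rfl⟩ := h
  refine ⟨{ comul := μ[A].op, counit := η[A].op, counit_comul := Quiver.Hom.unop_inj ?_,
            comul_counit := Quiver.Hom.unop_inj ?_, comul_assoc := Quiver.Hom.unop_inj ?_ },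
            rfl, rfl⟩
  all_goals simp

theorem IsCoalgebraHom.op {A B : C} {d : A ⟶ A ⊗ A} {c : A ⟶ 𝟙_ C} {d' : B ⟶ B ⊗ B}
    {c' : B ⟶ 𝟙_ C} {f : A ⟶ B} (h : IsCoalgebraHom d c d' c' f) :
    IsAlgebraHom (C := Cᵒᵖ) (A := op B) (A' := op A) d'.op c'.op d.op c.op f.op :=
  ⟨congrArg Quiver.Hom.op h.map_comul, congrArg Quiver.Hom.op h.map_counit⟩

theorem IsAlgebraHom.unop {A B : C} {d : A ⟶ A ⊗ A} {c : A ⟶ 𝟙_ C} {d' : B ⟶ B ⊗ B}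
    {c' : B ⟶ 𝟙_ C} {f : A ⟶ B}
    (h : IsAlgebraHom (C := Cᵒᵖ) (A := op B) (A' := op A) d'.op c'.op d.op c.op f.op) :
    IsCoalgebraHom d c d' c' f where
  map_comul := by
    apply Quiver.Hom.op_inj
    simpa using h.map_mul
  map_counit := Quiver.Hom.op_inj h.map_one

section

variable {H X Y : C}

theorem IsModuleHom.op {a : X ⊗ H ⟶ X} {b : Y ⊗ H ⟶ Y} {f : X ⟶ Y} (h : IsModuleHom a b f) :
    IsComoduleHom (C := Cᵒᵖ) (H := .op H) (X := .op Y) (Y := .op X) b.op a.op f.op := by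
  unfold IsModuleHom IsComoduleHom at *
  simpa using congrArg Quiver.Hom.op h

theorem IsComoduleHom.op {a : X ⟶ X ⊗ H} {b : Y ⟶ Y ⊗ H} {f : X ⟶ Y} (h : IsComoduleHom a b f) :
    IsModuleHom (C := Cᵒᵖ) (H := .op H) (X := .op Y) (Y := .op X) b.op a.op f.op := by
  unfold IsModuleHom IsComoduleHom at *
  simpa using congrArg Quiver.Hom.op h

theorem IsModuleHom.unop {a : X ⟶ X ⊗ H} {b : Y ⟶ Y ⊗ H} {f : X ⟶ Y}
    (h : IsModuleHom (C := Cᵒᵖ) (H := .op H) (X := .op Y) (Y := .op X) b.op a.op f.op) :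
    IsComoduleHom a b f := by
  unfold IsModuleHom IsComoduleHom at *
  simpa using congrArg Quiver.Hom.unop h

end

namespace CrossData

variable {H : C} (D : CrossData H)

/-- The same data in the opposite category: algebra and coalgebra, module and comodule structure
exchange their roles. -/
def op : CrossData (Opposite.op H) where
  X := Opposite.op D.X
  mul := D.comul.op
  one := D.counit.op
  comul := D.mul.op
  counit := D.one.op
  act := D.coact.op
  coact := D.act.op

theorem op_inj : D.op.inj = D.proj.op := rfl
theorem op_proj : D.op.proj = D.inj.op := rfl

/-- The morphism `x ⊗ (h ⊗ y) ↦ (x · h) y`, which is the left action of `X` on `H ⋉ X` followed by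
the projection on `X`. -/
def crossAct : D.X ⊗ (H ⊗ D.X) ⟶ D.X := (α_ D.X H D.X).inv ≫ D.act ▷ D.X ≫ D.mul

/-- The morphism dual to `crossAct`, `x ↦ x₍₁₎₍₀₎ ⊗ x₍₁₎₍₁₎ ⊗ x₍₂₎`. -/
def crossCoact : D.X ⟶ D.X ⊗ (H ⊗ D.X) := D.comul ≫ D.coact ▷ D.X ≫ (α_ D.X H D.X).hom

theorem op_crossAct : D.op.crossAct = D.crossCoact.op := by
  simp [crossAct, crossCoact, CrossData.op]

end CrossData

variable [BraidedCategory C]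

/-- A bialgebra `H` in `C`, regarded as a bialgebra in `Cᵒᵖ`, whose multiplication is the
comultiplication of `H`. -/
instance opBimonObj {H : C} [BimonObj H] : BimonObj (op H) where
  mul := Δ[H].op
  one := ε[H].op
  comul := μ[H].op
  counit := η[H].op
  one_mul := Quiver.Hom.unop_inj (by simp)
  mul_one := Quiver.Hom.unop_inj (by simp)
  mul_assoc := Quiver.Hom.unop_inj (by simp)
  counit_comul := Quiver.Hom.unop_inj (by simp)
  comul_counit := Quiver.Hom.unop_inj (by simp)
  comul_assoc := Quiver.Hom.unop_inj (by simp)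
  mul_comul := by
    change Δ[H].op ≫ μ[H].op = _
    rw [← op_comp, BimonObj.mul_comul]
    simp
  one_comul := by
    change ε[H].op ≫ μ[H].op = _
    rw [← op_comp, BimonObj.mul_counit]
    simp
    rfl
  mul_counit := by
    change Δ[H].op ≫ η[H].op = _
    rw [← op_comp, BimonObj.one_comul, MonObj.tensorObj.one_def]
    simp
  one_counit := Quiver.Hom.unop_inj (by simp)

theorem op_comul {H : C} [BimonObj H] : Δ[op H] = μ[H].op := rfl
theorem op_counit {H : C} [BimonObj H] : ε[op H] = η[H].op := rfl
theorem op_mul {H : C} [BimonObj H] : μ[op H] = Δ[H].op := rfl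
theorem op_one {H : C} [BimonObj H] : η[op H] = ε[H].op := rfl

section

variable {H X Y : C} [BimonObj H]

theorem diagAct_op (c : X ⟶ X ⊗ H) (c' : Y ⟶ Y ⊗ H) :
    diagAct (H := op H) (X := op X) (Y := op Y) c.op c'.op = (diagCoact c c').op := by
  simp [diagAct, diagCoact, op_comul]

theorem diagCoact_op (a : X ⊗ H ⟶ X) (a' : Y ⊗ H ⟶ Y) :
    diagCoact (H := op H) (X := op X) (Y := op Y) a.op a'.op = (diagAct a a').op := by
  simp [diagAct, diagCoact, op_mul]

theorem unitAct_op : unitAct (op H) = (unitCoact H).op := by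
  rfl

theorem unitCoact_op : unitCoact (op H) = (unitAct H).op := by
  rfl

theorem IsRightComodule.op {c : X ⟶ X ⊗ H} (h : IsRightComodule c) :
    IsRightModule (C := Cᵒᵖ) (H := op H) (X := op X) c.op where
  act_one := by simpa [op_one] using congrArg Quiver.Hom.op h.coact_counit
  act_mul := by simpa [op_mul] using congrArg Quiver.Hom.op h.coact_comul

theorem IsRightModule.op {a : X ⊗ H ⟶ X} (h : IsRightModule a) :
    IsRightComodule (C := Cᵒᵖ) (H := op H) (X := op X) a.op where
  coact_counit := by simpa [op_counit] using congrArg Quiver.Hom.op h.act_one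
  coact_comul := by
    have := congrArg Quiver.Hom.op h.act_mul
    simp at this
    simp [op_comul, this]

end

namespace CrossData

variable {H : C}

variable [BimonObj H] (D : CrossData H)

theorem op_swap : D.op.swap = D.coswap.op := by
  simp [swap, coswap, CrossData.op, op_comul]

theorem op_coswap : D.op.coswap = D.swap.op := by
  simp [swap, coswap, CrossData.op, op_mul]

theorem op_crossMul : D.op.crossMul = D.crossComul.op := by
  simp only [crossMul, op_swap]
  simp [crossComul, CrossData.op, op_mul]

theorem op_crossOne : D.op.crossOne = D.crossCounit.op := by
  simp [crossOne, crossCounit, CrossData.op, op_one]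

theorem op_crossComul : D.op.crossComul = D.crossMul.op := by
  simp only [crossComul, op_coswap]
  simp [crossMul, CrossData.op, op_comul]

theorem op_crossCounit : D.op.crossCounit = D.crossOne.op := by
  simp [crossOne, crossCounit, CrossData.op, op_counit]

variable {D}

theorem IsComoduleCoalgebra.op (h : D.IsComoduleCoalgebra) : D.op.IsModuleAlgebra where
  isAlgebra := h.isCoalgebra.op
  isRightModule := h.isRightComodule.op
  mul_hom := by
    have := h.comul_hom.op
    rwa [← diagAct_op] at this
  one_hom := by
    have := h.counit_hom.op
    rwa [← unitAct_op] at this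

theorem IsModuleAlgebra.op (h : D.IsModuleAlgebra) : D.op.IsComoduleCoalgebra where
  isCoalgebra := h.isAlgebra.op
  isRightComodule := h.isRightModule.op
  comul_hom := by
    have := h.mul_hom.op
    rwa [← diagCoact_op] at this
  counit_hom := by
    have := h.one_hom.op
    rwa [← unitCoact_op] at this

/-- Admissibility is self-dual. -/
theorem IsAdmissible.op (h : D.IsAdmissible) : D.op.IsAdmissible where
  isModuleAlgebra := h.isComoduleCoalgebra.op
  isComoduleCoalgebra := h.isModuleAlgebra.op
  isBialgebra := by
    obtain ⟨s, h1, h2, h3, h4⟩ := h.isBialgebra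
    rw [op_crossMul, op_crossOne, op_crossComul, op_crossCounit, ← h1, ← h2, ← h3, ← h4]
    exact ⟨@opBimonObj _ _ _ _ _ s, rfl, rfl, rfl, rfl⟩

end CrossData

end Duality

/-! ### The cross product algebra and the cross coproduct coalgebra -/

section

variable {C : Type u} [Category.{v} C] [MonoidalCategory.{v} C] [BraidedCategory C]

namespace CrossData

variable {H : C} [BimonObj H] {D : CrossData H}

/-- For a module algebra `X` the morphism `swap` is a distributive law, and the cross product
algebra is the resulting twisted tensor product. -/
theorem IsModuleAlgebra.isDistributiveLaw (h : D.IsModuleAlgebra) :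
    IsDistributiveLaw μ[H] η[H] D.mul D.one D.swap where
  one_left := by
    refine (swapMap_natural Δ[H] h.one_hom).trans ?_
    rw [unitAct, swapMap_unit (ComonObj.comul_counit H), Category.assoc]
  one_right := swapMap_one (by simp [MonObj.tensorObj.one_def]) h.isRightModule.act_one
  mul_left := by
    refine (swapMap_natural Δ[H] h.mul_hom).trans ?_
    rw [swapMap_diagAct]
    simp only [Category.assoc]
    rfl
  mul_right := swapMap_mul (BimonObj.mul_comul H) h.isRightModule.act_mul

theorem IsModuleAlgebra.isAlgebra_cross (h : D.IsModuleAlgebra) :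
    IsAlgebra D.crossMul D.crossOne :=
  h.isDistributiveLaw.isAlgebra ⟨inferInstance, rfl, rfl⟩ h.isAlgebra

theorem IsComoduleCoalgebra.isCoalgebra_cross (h : D.IsComoduleCoalgebra) :
    IsCoalgebra D.crossComul D.crossCounit := by
  have := h.op.isAlgebra_cross
  rw [op_crossMul, op_crossOne] at this
  exact this.unop

end CrossData

end

/-! ### Inclusions in the twisted tensor product -/

section

variable {C : Type u} [Category.{v} C] [MonoidalCategory.{v} C]
variable {A B : C} {mA : A ⊗ A ⟶ A} {eA : 𝟙_ C ⟶ A} {mB : B ⊗ B ⟶ B}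
    {eB : 𝟙_ C ⟶ B} {s : B ⊗ A ⟶ A ⊗ B}

/-- The morphism `a ↦ a ⊗ 1` to the twisted tensor product. -/
def twistInl (A : C) (eB : 𝟙_ C ⟶ B) : A ⟶ A ⊗ B := (ρ_ A).inv ≫ A ◁ eB

/-- The morphism `b ↦ 1 ⊗ b` to the twisted tensor product. -/
def twistInr (B : C) (eA : 𝟙_ C ⟶ A) : B ⟶ A ⊗ B := (λ_ B).inv ≫ eA ▷ B

theorem IsDistributiveLaw.twistInl_whiskerRight (hs : IsDistributiveLaw mA eA mB eB s)
    (hB : IsAlgebra mB eB) :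
    twistInl A eB ▷ (A ⊗ B) ≫ twistMul mA mB s = (α_ A A B).inv ≫ mA ▷ B := by
  obtain ⟨sB, rfl, rfl⟩ := hB
  calc _ = 𝟙 _ ⊗≫ A ◁ (η[B] ▷ A ≫ s) ▷ B ⊗≫ A ◁ A ◁ μ[B] ⊗≫ mA ▷ B := by
        rw [twistInl, twistMul, MonoidalCategory.tensorHom_def']; monoidal
    _ = 𝟙 _ ⊗≫ A ◁ A ◁ (η[B] ▷ B ≫ μ[B]) ⊗≫ mA ▷ B := by
        rw [hs.one_left]; monoidal
    _ = _ := by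
        rw [MonObj.one_mul]; monoidal

theorem IsDistributiveLaw.whiskerLeft_twistInr (hs : IsDistributiveLaw mA eA mB eB s)
    (hA : IsAlgebra mA eA) :
    (A ⊗ B) ◁ twistInr B eA ≫ twistMul mA mB s = (α_ A B B).hom ≫ A ◁ mB := by
  obtain ⟨sA, rfl, rfl⟩ := hA
  calc _ = 𝟙 _ ⊗≫ A ◁ (B ◁ η[A] ≫ s) ▷ B ⊗≫ μ[A] ▷ (B ⊗ B) ⊗≫ A ◁ mB := by
        rw [twistInr, twistMul, MonoidalCategory.tensorHom_def]; monoidal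
    _ = 𝟙 _ ⊗≫ (A ◁ η[A] ≫ μ[A]) ▷ (B ⊗ B) ⊗≫ A ◁ mB := by
        rw [hs.one_right]; monoidal
    _ = _ := by
        rw [MonObj.mul_one]; monoidal

/-- In the twisted tensor product `(a ⊗ 1)(1 ⊗ b) = a ⊗ b`. -/
theorem IsDistributiveLaw.twistInl_twistInr (hs : IsDistributiveLaw mA eA mB eB s)
    (hA : IsAlgebra mA eA) (hB : IsAlgebra mB eB) :
    (twistInl A eB ⊗ₘ twistInr B eA) ≫ twistMul mA mB s = 𝟙 _ := by
  rw [MonoidalCategory.tensorHom_def', Category.assoc, hs.twistInl_whiskerRight hB]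
  obtain ⟨sA, rfl, rfl⟩ := hA
  calc _ = 𝟙 _ ⊗≫ (A ◁ η[A] ≫ μ[A]) ▷ B := by rw [twistInr]; monoidal
    _ = _ := by rw [MonObj.mul_one]; monoidal

/-- In the twisted tensor product `(1 ⊗ b)(a ⊗ 1) = s(b ⊗ a)`. -/
theorem twistInr_twistInl (hA : IsAlgebra mA eA) (hB : IsAlgebra mB eB) :
    (twistInr B eA ⊗ₘ twistInl A eB) ≫ twistMul mA mB s = s := by
  obtain ⟨sA, rfl, rfl⟩ := hA
  obtain ⟨sB, rfl, rfl⟩ := hB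
  calc _ = 𝟙 _ ⊗≫ η[A] ▷ (B ⊗ A) ⊗≫ (A ◁ ((B ⊗ A) ◁ η[B] ≫ s ▷ B)) ⊗≫ A ◁ A ◁ μ[B] ⊗≫
          μ[A] ▷ B := by
        rw [MonoidalCategory.tensorHom_def, twistMul, MonoidalCategory.tensorHom_def', twistInr,
          twistInl]
        monoidal
    _ = 𝟙 _ ⊗≫ (η[A] ▷ (B ⊗ A) ≫ A ◁ s) ⊗≫ A ◁ A ◁ (B ◁ η[B] ≫ μ[B]) ⊗≫
          μ[A] ▷ B := by
        rw [whisker_exchange]; monoidal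
    _ = 𝟙 _ ⊗≫ s ⊗≫ (η[A] ▷ A ≫ μ[A]) ▷ B := by
        rw [← whisker_exchange, MonObj.mul_one]; monoidal
    _ = _ := by
        rw [MonObj.one_mul]; monoidal

theorem IsDistributiveLaw.isAlgebraHom_twistInl (hs : IsDistributiveLaw mA eA mB eB s)
    (hB : IsAlgebra mB eB) :
    IsAlgebraHom mA eA (twistMul mA mB s) ((λ_ (𝟙_ C)).inv ≫ (eA ⊗ₘ eB)) (twistInl A eB) where
  map_mul := by
    rw [MonoidalCategory.tensorHom_def', Category.assoc, hs.twistInl_whiskerRight hB, twistInl]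
    calc _ = 𝟙 _ ⊗≫ (mA ▷ (𝟙_ C) ≫ A ◁ eB) := by monoidal
      _ = _ := by rw [← whisker_exchange]; monoidal
  map_one := by
    rw [twistInl, MonoidalCategory.tensorHom_def]; monoidal

theorem IsDistributiveLaw.isAlgebraHom_twistInr (hs : IsDistributiveLaw mA eA mB eB s)
    (hA : IsAlgebra mA eA) :
    IsAlgebraHom mB eB (twistMul mA mB s) ((λ_ (𝟙_ C)).inv ≫ (eA ⊗ₘ eB)) (twistInr B eA) where
  map_mul := by
    rw [MonoidalCategory.tensorHom_def, Category.assoc, hs.whiskerLeft_twistInr hA, twistInr]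
    calc _ = 𝟙 _ ⊗≫ ((𝟙_ C) ◁ mB ≫ eA ▷ B) := by monoidal
      _ = _ := by rw [whisker_exchange]; monoidal
  map_one := by
    rw [twistInr, MonoidalCategory.tensorHom_def']; monoidal

/-- If `g` and `g'` commute with `f` up to `s` and `s'`, then the product `v ⊗ w ↦ g(v) g'(w)`
commutes with `f` up to the composite of `s` and `s'`. -/
theorem commute_mul {T H V W : C} [MonObj T] {f : H ⟶ T} {g : V ⟶ T} {g' : W ⟶ T}
    {s : V ⊗ H ⟶ H ⊗ V} {s' : W ⊗ H ⟶ H ⊗ W}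
    (h : (g ⊗ₘ f) ≫ μ[T] = s ≫ (f ⊗ₘ g) ≫ μ[T]) (h' : (g' ⊗ₘ f) ≫ μ[T] = s' ≫ (f ⊗ₘ g') ≫ μ[T]) :
    (((g ⊗ₘ g') ≫ μ[T]) ⊗ₘ f) ≫ μ[T] =
      ((α_ V W H).hom ≫ V ◁ s' ≫ (α_ V H W).inv ≫ s ▷ W ≫ (α_ H V W).hom) ≫
        (f ⊗ₘ ((g ⊗ₘ g') ≫ μ[T])) ≫ μ[T] := by
  have hl {X Y : C} (x : X ⟶ T ⊗ T) (y : Y ⟶ T) : (x ≫ μ[T]) ⊗ₘ y = (x ⊗ₘ y) ≫ μ[T] ▷ T := by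
    rw [← tensorHom_id, tensorHom_comp_tensorHom, Category.comp_id]
  have hr {X Y : C} (x : X ⟶ T ⊗ T) (y : Y ⟶ T) : y ⊗ₘ (x ≫ μ[T]) = (y ⊗ₘ x) ≫ T ◁ μ[T] := by
    rw [← id_tensorHom, tensorHom_comp_tensorHom, Category.comp_id]
  calc _ = (α_ V W H).hom ≫ (g ⊗ₘ ((g' ⊗ₘ f) ≫ μ[T])) ≫ μ[T] := by
        rw [hl, hr, Category.assoc, Category.assoc, MonObj.mul_assoc, associator_naturality_assoc]
    _ = (α_ V W H).hom ≫ (𝟙 V ⊗ₘ s') ≫ (g ⊗ₘ ((f ⊗ₘ g') ≫ μ[T])) ≫ μ[T] := by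
        rw [h', tensorHom_comp_tensorHom_assoc, Category.id_comp]
    _ = (α_ V W H).hom ≫ V ◁ s' ≫ (α_ V H W).inv ≫ (((g ⊗ₘ f) ≫ μ[T]) ⊗ₘ g') ≫ μ[T] := by
        rw [hl, hr, Category.assoc, Category.assoc, MonObj.mul_assoc_flip,
          associator_inv_naturality_assoc, id_tensorHom]
    _ = (α_ V W H).hom ≫ V ◁ s' ≫ (α_ V H W).inv ≫ (s ⊗ₘ 𝟙 W) ≫ (((f ⊗ₘ g) ≫ μ[T]) ⊗ₘ g') ≫
          μ[T] := by
        rw [h, tensorHom_comp_tensorHom_assoc, Category.id_comp]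
    _ = _ := by
        rw [hl, hr, Category.assoc, Category.assoc, MonObj.mul_assoc, associator_naturality_assoc,
          tensorHom_id]
        simp only [Category.assoc]

end

/-! ### Commutation relations in the tensor square of an algebra -/

section

variable {C : Type u} [Category.{v} C] [MonoidalCategory.{v} C] [BraidedCategory C]

/-- Comultiplying the factor `H` of `swapMap` amounts to comultiplying first and swapping
afterwards. -/
theorem swapMap_comul {H V : C} [ComonObj H] (a : V ⊗ H ⟶ V) :
    swapMap Δ[H] a ≫ Δ[H] ▷ V ≫ (α_ H H V).hom =
      V ◁ Δ[H] ≫ (α_ V H H).inv ≫ (β_ V H).hom ▷ H ≫ (α_ H V H).hom ≫ H ◁ swapMap Δ[H] a := by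
  calc _ = 𝟙 _ ⊗≫ V ◁ Δ[H] ⊗≫ (β_ V H).hom ▷ H ⊗≫ (H ◁ a ≫ Δ[H] ▷ V) ⊗≫ 𝟙 _ := by
        rw [swapMap]; monoidal
    _ = 𝟙 _ ⊗≫ V ◁ Δ[H] ⊗≫ ((β_ V H).hom ≫ Δ[H] ▷ V) ▷ H ⊗≫ H ◁ H ◁ a ⊗≫ 𝟙 _ := by
        rw [whisker_exchange]; monoidal
    _ = 𝟙 _ ⊗≫ V ◁ (Δ[H] ≫ Δ[H] ▷ H) ⊗≫ (β_ V H).hom ▷ H ▷ H ⊗≫ H ◁ (β_ V H).hom ▷ H ⊗≫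
          H ◁ H ◁ a ⊗≫ 𝟙 _ := by
        rw [← BraidedCategory.braiding_naturality_right,
          BraidedCategory.braiding_tensor_right_hom]; monoidal
    _ = 𝟙 _ ⊗≫ V ◁ Δ[H] ⊗≫ ((V ⊗ H) ◁ Δ[H] ≫ (β_ V H).hom ▷ (H ⊗ H)) ⊗≫ H ◁ (β_ V H).hom ▷ H ⊗≫
          H ◁ H ◁ a ⊗≫ 𝟙 _ := by
        rw [ComonObj.comul_assoc_flip]; monoidal
    _ = _ := by
        rw [whisker_exchange, swapMap]; monoidal

/-- The product of two decomposable morphisms to the tensor product algebra `B ⊗ B`. -/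
theorem tensorHom_mul {B P₁ P₂ Q₁ Q₂ : C} [MonObj B] (f₁ : P₁ ⟶ B) (f₂ : P₂ ⟶ B) (g₁ : Q₁ ⟶ B)
    (g₂ : Q₂ ⟶ B) : ((f₁ ⊗ₘ f₂) ⊗ₘ (g₁ ⊗ₘ g₂)) ≫ μ[B ⊗ B] =
      tensorμ P₁ P₂ Q₁ Q₂ ≫ (((f₁ ⊗ₘ g₁) ≫ μ[B]) ⊗ₘ ((f₂ ⊗ₘ g₂) ≫ μ[B])) := by
  rw [MonObj.tensorObj.mul_def, tensorμ_natural_assoc, tensorHom_comp_tensorHom]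

theorem tensorμ_unit_left (X P Q : C) :
    (λ_ X).inv ▷ (P ⊗ Q) ≫ tensorμ (𝟙_ C) X P Q ≫ (λ_ P).hom ▷ (X ⊗ Q) =
      (α_ X P Q).inv ≫ (β_ X P).hom ▷ Q ≫ (α_ P X Q).hom := by
  rw [tensorμ]; monoidal

theorem tensorμ_unit_right (X P Q : C) :
    (P ⊗ Q) ◁ (λ_ X).inv ≫ tensorμ P Q (𝟙_ C) X ≫ (ρ_ P).hom ▷ (Q ⊗ X) = (α_ P Q X).hom := by
  rw [tensorμ, braiding_tensorUnit_right]; monoidal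

section

variable {B H X : C} [MonObj B]

/-- The morphism `x ↦ 1 ⊗ i(x)` to the tensor product algebra `B ⊗ B`. -/
def inSnd (i : X ⟶ B) : X ⟶ B ⊗ B := (λ_ X).inv ≫ (η[B] ⊗ₘ i)

theorem inSnd_mul {P Q : C} (i : X ⟶ B) (f : P ⟶ B) (g : Q ⟶ B) :
    (inSnd i ⊗ₘ (f ⊗ₘ g)) ≫ μ[B ⊗ B] =
      (α_ X P Q).inv ≫ (β_ X P).hom ▷ Q ≫ (α_ P X Q).hom ≫ (f ⊗ₘ ((i ⊗ₘ g) ≫ μ[B])) := by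
  have h : inSnd i ⊗ₘ (f ⊗ₘ g) = (λ_ X).inv ▷ (P ⊗ Q) ≫ ((η[B] ⊗ₘ i) ⊗ₘ (f ⊗ₘ g)) := by
    rw [← tensorHom_id, tensorHom_comp_tensorHom, Category.id_comp, inSnd]
  have h2 : (η[B] ⊗ₘ f) ≫ μ[B] = (λ_ P).hom ≫ f := by simp
  have h3 : ((λ_ P).hom ≫ f) ⊗ₘ ((i ⊗ₘ g) ≫ μ[B]) =
      (λ_ P).hom ▷ (X ⊗ Q) ≫ (f ⊗ₘ ((i ⊗ₘ g) ≫ μ[B])) := by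
    rw [← tensorHom_id, tensorHom_comp_tensorHom, Category.id_comp]
  have h4 := tensorμ_unit_left X P Q
  rw [h, Category.assoc, tensorHom_mul, h2, h3, reassoc_of% h4]

theorem mul_inSnd {P Q : C} (i : X ⟶ B) (f : P ⟶ B) (g : Q ⟶ B) :
    ((f ⊗ₘ g) ⊗ₘ inSnd i) ≫ μ[B ⊗ B] =
      (α_ P Q X).hom ≫ (f ⊗ₘ ((g ⊗ₘ i) ≫ μ[B])) := by
  have h : (f ⊗ₘ g) ⊗ₘ inSnd i = (P ⊗ Q) ◁ (λ_ X).inv ≫ ((f ⊗ₘ g) ⊗ₘ (η[B] ⊗ₘ i)) := by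
    rw [← id_tensorHom, tensorHom_comp_tensorHom, Category.id_comp, inSnd]
  have h2 : (f ⊗ₘ η[B]) ≫ μ[B] = (ρ_ P).hom ≫ f := by simp
  have h3 : ((ρ_ P).hom ≫ f) ⊗ₘ ((g ⊗ₘ i) ≫ μ[B]) =
      (ρ_ P).hom ▷ (Q ⊗ X) ≫ (f ⊗ₘ ((g ⊗ₘ i) ≫ μ[B])) := by
    rw [← tensorHom_id, tensorHom_comp_tensorHom, Category.id_comp]
  have h4 := tensorμ_unit_right X P Q
  rw [h, Category.assoc, tensorHom_mul, h2, h3, reassoc_of% h4]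

theorem isAlgebraHom_inSnd {m : X ⊗ X ⟶ X} {e : 𝟙_ C ⟶ X} {i : X ⟶ B}
    (hi : IsAlgebraHom m e μ[B] η[B] i) :
    IsAlgebraHom m e μ[B ⊗ B] η[B ⊗ B] (inSnd i) where
  map_mul := by
    have h : inSnd i ⊗ₘ inSnd i = X ◁ (λ_ X).inv ≫ (inSnd i ⊗ₘ (η[B] ⊗ₘ i)) := by
      rw [← id_tensorHom, tensorHom_comp_tensorHom, Category.id_comp, ← inSnd]
    rw [h, Category.assoc, inSnd_mul, ← hi.map_mul, inSnd, braiding_tensorUnit_right,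
      MonoidalCategory.tensorHom_def', MonoidalCategory.tensorHom_def']
    monoidal
  map_one := by
    rw [inSnd, MonObj.tensorObj.one_def, ← hi.map_one, MonoidalCategory.tensorHom_def',
      MonoidalCategory.tensorHom_def']
    monoidal

/-- If `i` and `j` satisfy the commutation relation of the cross product, then so do `x ↦ 1 ⊗
i(x)` and `h ↦ j(h₍₁₎) ⊗ j(h₍₂₎)`. -/
theorem comul_commute_inSnd [ComonObj H] {a : X ⊗ H ⟶ X} {i : X ⟶ B} {j : H ⟶ B}
    (hs : (i ⊗ₘ j) ≫ μ[B] = swapMap Δ[H] a ≫ (j ⊗ₘ i) ≫ μ[B]) :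
    (inSnd i ⊗ₘ (Δ[H] ≫ (j ⊗ₘ j))) ≫ μ[B ⊗ B] =
      swapMap Δ[H] a ≫ ((Δ[H] ≫ (j ⊗ₘ j)) ⊗ₘ inSnd i) ≫ μ[B ⊗ B] := by
  have h1 : inSnd i ⊗ₘ (Δ[H] ≫ (j ⊗ₘ j)) = X ◁ Δ[H] ≫ (inSnd i ⊗ₘ (j ⊗ₘ j)) := by
    rw [← id_tensorHom, tensorHom_comp_tensorHom, Category.id_comp]
  have h2 : (Δ[H] ≫ (j ⊗ₘ j)) ⊗ₘ inSnd i = Δ[H] ▷ X ≫ ((j ⊗ₘ j) ⊗ₘ inSnd i) := by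
    rw [← tensorHom_id, tensorHom_comp_tensorHom, Category.id_comp]
  have h3 : j ⊗ₘ (swapMap Δ[H] a ≫ (j ⊗ₘ i) ≫ μ[B]) =
      H ◁ swapMap Δ[H] a ≫ (j ⊗ₘ ((j ⊗ₘ i) ≫ μ[B])) := by
    rw [← id_tensorHom, tensorHom_comp_tensorHom, Category.id_comp]
  have h4 := swapMap_comul a
  rw [h1, h2, Category.assoc, Category.assoc, inSnd_mul, mul_inSnd, hs, h3, reassoc_of% h4]

/-- If `i` and `j` satisfy the commutation relation of the cross product, then so do
`x ↦ i(x₍₀₎) ⊗ j(x₍₁₎)` and `h ↦ j(h₍₁₎) ⊗ j(h₍₂₎)`. The compatibility of action and coaction in a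
crossed module is what makes this true. -/
theorem comul_commute_coact [BimonObj H] {a : X ⊗ H ⟶ X} {c : X ⟶ X ⊗ H} {i : X ⟶ B} {j : H ⟶ B}
    (hc : IsCrossedModule a c) (hj : IsAlgebraHom μ[H] η[H] μ[B] η[B] j)
    (hs : (i ⊗ₘ j) ≫ μ[B] = swapMap Δ[H] a ≫ (j ⊗ₘ i) ≫ μ[B]) :
    ((c ≫ (i ⊗ₘ j)) ⊗ₘ (Δ[H] ≫ (j ⊗ₘ j))) ≫ μ[B ⊗ B] =
      swapMap Δ[H] a ≫ ((Δ[H] ≫ (j ⊗ₘ j)) ⊗ₘ (c ≫ (i ⊗ₘ j))) ≫ μ[B ⊗ B] := by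
  have key : (c ⊗ₘ Δ[H]) ≫ tensorμ X H H H ≫ (swapMap Δ[H] a ⊗ₘ μ[H]) =
      swapMap Δ[H] a ≫ (Δ[H] ⊗ₘ c) ≫ tensorμ H H X H ≫ ((H ⊗ X) ◁ μ[H]) := by
    symm
    calc _ = 𝟙 _ ⊗≫ (swapMap Δ[H] a ≫ Δ[H] ▷ X ≫ (α_ H H X).hom) ⊗≫ H ◁ (H ◁ c ⊗≫
              (β_ H X).hom ▷ H ⊗≫ X ◁ μ[H]) ⊗≫ 𝟙 _ := by
          rw [tensorμ, MonoidalCategory.tensorHom_def]; monoidal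
      _ = 𝟙 _ ⊗≫ X ◁ Δ[H] ⊗≫ (β_ X H).hom ▷ H ⊗≫ H ◁ (
            X ◁ Δ[H] ≫ (α_ X H H).inv ≫ (β_ X H).hom ▷ H ≫ (α_ H X H).hom ≫ H ◁ (a ≫ c) ≫
      (α_ H X H).inv ≫ (β_ H X).hom ▷ H ≫ (α_ X H H).hom ≫ X ◁ μ[H]) ⊗≫ 𝟙 _ := by
          rw [swapMap_comul, swapMap]; monoidal
      _ = 𝟙 _ ⊗≫ X ◁ Δ[H] ⊗≫ ((β_ X H).hom ▷ H ≫ (H ⊗ X) ◁ Δ[H]) ⊗≫ H ◁ c ▷ (H ⊗ H) ⊗≫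
            H ◁ X ◁ (β_ H H).hom ▷ H ⊗≫ H ◁ (a ⊗ₘ μ[H]) ⊗≫ 𝟙 _ := by
          rw [hc.compatibility, tensorμ, MonoidalCategory.tensorHom_def' c]; monoidal
      _ = 𝟙 _ ⊗≫ X ◁ Δ[H] ⊗≫ X ◁ H ◁ Δ[H] ⊗≫ ((β_ X H).hom ≫ H ◁ c) ▷ (H ⊗ H) ⊗≫
            H ◁ X ◁ (β_ H H).hom ▷ H ⊗≫ H ◁ (a ⊗ₘ μ[H]) ⊗≫ 𝟙 _ := by
          rw [← whisker_exchange]; monoidal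
      _ = 𝟙 _ ⊗≫ X ◁ (Δ[H] ≫ H ◁ Δ[H]) ⊗≫ c ▷ H ▷ (H ⊗ H) ⊗≫ X ◁ (β_ H H).hom ▷ (H ⊗ H) ⊗≫
            ((β_ X H).hom ▷ (H ⊗ H) ≫ (H ⊗ X) ◁ (β_ H H).hom) ▷ H ⊗≫ H ◁ (a ⊗ₘ μ[H]) ⊗≫ 𝟙 _ := by
          rw [← BraidedCategory.braiding_naturality_left,
            BraidedCategory.braiding_tensor_left_hom]; monoidal
      _ = 𝟙 _ ⊗≫ X ◁ (Δ[H] ≫ Δ[H] ▷ H) ⊗≫ c ▷ (H ⊗ H) ▷ H ⊗≫ X ◁ (β_ H (H ⊗ H)).hom ▷ H ⊗≫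
            (β_ X H).hom ▷ H ▷ H ▷ H ⊗≫ H ◁ (a ⊗ₘ μ[H]) ⊗≫ 𝟙 _ := by
          rw [← whisker_exchange, BraidedCategory.braiding_tensor_right_hom,
            ComonObj.comul_assoc]; monoidal
      _ = 𝟙 _ ⊗≫ X ◁ Δ[H] ⊗≫ (X ◁ Δ[H] ≫ c ▷ (H ⊗ H)) ▷ H ⊗≫ X ◁ (β_ H (H ⊗ H)).hom ▷ H ⊗≫
            (β_ X H).hom ▷ H ▷ H ▷ H ⊗≫ H ◁ (a ⊗ₘ μ[H]) ⊗≫ 𝟙 _ := by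
          monoidal
      _ = 𝟙 _ ⊗≫ X ◁ Δ[H] ⊗≫ c ▷ (H ⊗ H) ⊗≫ X ◁ (H ◁ Δ[H] ≫ (β_ H (H ⊗ H)).hom) ▷ H ⊗≫
            (β_ X H).hom ▷ H ▷ H ▷ H ⊗≫ H ◁ (a ⊗ₘ μ[H]) ⊗≫ 𝟙 _ := by
          rw [whisker_exchange]; monoidal
      _ = _ := by
          rw [BraidedCategory.braiding_naturality_right, tensorμ, swapMap,
            MonoidalCategory.tensorHom_def' c, MonoidalCategory.tensorHom_def a,
            MonoidalCategory.tensorHom_def (_ ≫ _)]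
          monoidal
  have h1 : (c ≫ (i ⊗ₘ j)) ⊗ₘ (Δ[H] ≫ (j ⊗ₘ j)) = (c ⊗ₘ Δ[H]) ≫ ((i ⊗ₘ j) ⊗ₘ (j ⊗ₘ j)) := by
    rw [tensorHom_comp_tensorHom]
  have h2 : (Δ[H] ≫ (j ⊗ₘ j)) ⊗ₘ (c ≫ (i ⊗ₘ j)) = (Δ[H] ⊗ₘ c) ≫ ((j ⊗ₘ j) ⊗ₘ (i ⊗ₘ j)) := by
    rw [tensorHom_comp_tensorHom]
  have h3 : (swapMap Δ[H] a ≫ (j ⊗ₘ i) ≫ μ[B]) ⊗ₘ (μ[H] ≫ j) =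
      (swapMap Δ[H] a ⊗ₘ μ[H]) ≫ (((j ⊗ₘ i) ≫ μ[B]) ⊗ₘ j) := by
    rw [tensorHom_comp_tensorHom]
  have h4 : ((j ⊗ₘ i) ≫ μ[B]) ⊗ₘ (μ[H] ≫ j) =
      (H ⊗ X) ◁ μ[H] ≫ (((j ⊗ₘ i) ≫ μ[B]) ⊗ₘ j) := by
    rw [← id_tensorHom, tensorHom_comp_tensorHom, Category.id_comp]
  rw [h1, h2, Category.assoc, Category.assoc, tensorHom_mul, tensorHom_mul, hs, ← hj.map_mul, h3,
    h4, reassoc_of% key]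

/-- The morphisms `x ↦ 1 ⊗ i(x)` and `x ↦ i(x₍₀₎) ⊗ j(x₍₁₎)` commute up to the braiding of crossed
modules. -/
theorem inSnd_commute_coact [BimonObj H] {a : X ⊗ H ⟶ X} {c : X ⟶ X ⊗ H} {i : X ⟶ B} {j : H ⟶ B}
    (hc : IsRightComodule c)
    (hs : (i ⊗ₘ j) ≫ μ[B] = swapMap Δ[H] a ≫ (j ⊗ₘ i) ≫ μ[B]) :
    (inSnd i ⊗ₘ (c ≫ (i ⊗ₘ j))) ≫ μ[B ⊗ B] =
      crossedBraiding a c ≫ ((c ≫ (i ⊗ₘ j)) ⊗ₘ inSnd i) ≫ μ[B ⊗ B] := by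
  have key : X ◁ c ≫ (α_ X X H).inv ≫ (β_ X X).hom ▷ H ≫ (α_ X X H).hom ≫ X ◁ swapMap Δ[H] a =
      crossedBraiding a c ≫ c ▷ X ≫ (α_ X H X).hom := by
    symm
    calc _ = 𝟙 _ ⊗≫ X ◁ c ⊗≫ (β_ X X).hom ▷ H ⊗≫ (X ◁ a ≫ c ▷ X) ⊗≫ 𝟙 _ := by
          rw [crossedBraiding]; monoidal
      _ = 𝟙 _ ⊗≫ X ◁ c ⊗≫ ((β_ X X).hom ≫ c ▷ X) ▷ H ⊗≫ X ◁ H ◁ a ⊗≫ 𝟙 _ := by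
          rw [whisker_exchange]; monoidal
      _ = 𝟙 _ ⊗≫ X ◁ (c ≫ c ▷ H ≫ (α_ X H H).hom) ⊗≫ (β_ X X).hom ▷ H ▷ H ⊗≫
            X ◁ (β_ X H).hom ▷ H ⊗≫ X ◁ H ◁ a ⊗≫ 𝟙 _ := by
          rw [← BraidedCategory.braiding_naturality_right,
            BraidedCategory.braiding_tensor_right_hom]; monoidal
      _ = 𝟙 _ ⊗≫ X ◁ c ⊗≫ ((X ⊗ X) ◁ Δ[H] ≫ (β_ X X).hom ▷ (H ⊗ H)) ⊗≫
            X ◁ (β_ X H).hom ▷ H ⊗≫ X ◁ H ◁ a ⊗≫ 𝟙 _ := by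
          rw [← hc.coact_comul]; monoidal
      _ = _ := by
          rw [whisker_exchange, swapMap]; monoidal
  have h1 : inSnd i ⊗ₘ (c ≫ (i ⊗ₘ j)) = X ◁ c ≫ (inSnd i ⊗ₘ (i ⊗ₘ j)) := by
    rw [← id_tensorHom, tensorHom_comp_tensorHom, Category.id_comp]
  have h2 : (c ≫ (i ⊗ₘ j)) ⊗ₘ inSnd i = c ▷ X ≫ ((i ⊗ₘ j) ⊗ₘ inSnd i) := by
    rw [← tensorHom_id, tensorHom_comp_tensorHom, Category.id_comp]
  have h3 : i ⊗ₘ (swapMap Δ[H] a ≫ (j ⊗ₘ i) ≫ μ[B]) =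
      X ◁ swapMap Δ[H] a ≫ (i ⊗ₘ ((j ⊗ₘ i) ≫ μ[B])) := by
    rw [← id_tensorHom, tensorHom_comp_tensorHom, Category.id_comp]
  rw [h1, h2, Category.assoc, Category.assoc, inSnd_mul, mul_inSnd, hs, h3, ← reassoc_of% key]

end

end

/-! ### Crossed module bialgebras give admissible pairs -/

section

variable {C : Type u} [Category.{v} C] [MonoidalCategory.{v} C] [BraidedCategory C]

theorem IsAlgebraHom.tensorHom {A B A' B' : C} {mA : A ⊗ A ⟶ A} {eA : 𝟙_ C ⟶ A} {mB : B ⊗ B ⟶ B}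
    {eB : 𝟙_ C ⟶ B} [MonObj A'] [MonObj B'] {f : A ⟶ A'} {g : B ⟶ B'}
    (hf : IsAlgebraHom mA eA μ[A'] η[A'] f) (hg : IsAlgebraHom mB eB μ[B'] η[B'] g) :
    IsAlgebraHom (tensorμ A B A B ≫ (mA ⊗ₘ mB)) ((λ_ (𝟙_ C)).inv ≫ (eA ⊗ₘ eB)) μ[A' ⊗ B']
      η[A' ⊗ B'] (f ⊗ₘ g) where
  map_mul := by
    rw [MonObj.tensorObj.mul_def, tensorμ_natural_assoc, Category.assoc, tensorHom_comp_tensorHom,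
      tensorHom_comp_tensorHom, hf.map_mul, hg.map_mul]
  map_one := by
    rw [MonObj.tensorObj.one_def, Category.assoc, tensorHom_comp_tensorHom, hf.map_one, hg.map_one]

namespace CrossData

variable {H : C} [BimonObj H] {D : CrossData H}

theorem IsCrossedModuleBialgebra.isModuleAlgebra (h : D.IsCrossedModuleBialgebra) :
    D.IsModuleAlgebra :=
  ⟨h.isAlgebra, h.isCrossedModule.isRightModule, h.mul_moduleHom, h.one_moduleHom⟩

theorem IsCrossedModuleBialgebra.isComoduleCoalgebra (h : D.IsCrossedModuleBialgebra) :
    D.IsComoduleCoalgebra :=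
  ⟨h.isCoalgebra, h.isCrossedModule.isRightComodule, h.comul_comoduleHom, h.counit_comoduleHom⟩

/-- The coaction is an algebra morphism to the braided tensor product `X ⊗ H`. -/
theorem IsCrossedModuleBialgebra.isAlgebraHom_coact (h : D.IsCrossedModuleBialgebra) :
    IsAlgebraHom D.mul D.one (tensorμ D.X H D.X H ≫ (D.mul ⊗ₘ μ[H]))
      ((λ_ (𝟙_ C)).inv ≫ (D.one ⊗ₘ η[H])) D.coact where
  map_mul := by
    have h1 : D.mul ≫ D.coact = diagCoact D.coact D.coact ≫ D.mul ▷ H := h.mul_comoduleHom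
    rw [h1, diagCoact, MonoidalCategory.tensorHom_def' D.mul]
    simp only [Category.assoc]
  map_one := by
    have h1 : D.one ≫ D.coact = unitCoact H ≫ D.one ▷ H := h.one_comoduleHom
    rw [h1, unitCoact, MonoidalCategory.tensorHom_def']
    simp

theorem IsCrossedModuleBialgebra.isAlgebraHom_crossCounit (h : D.IsCrossedModuleBialgebra) :
    IsAlgebraHom D.crossMul D.crossOne (λ_ (𝟙_ C)).hom (𝟙 (𝟙_ C)) D.crossCounit := by
  refine IsAlgebraHom.twist (T := 𝟙_ C) (f := ε[H]) (g := D.counit) ⟨?_, ?_⟩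
    h.counit_algebraHom ?_
  · simp
  · simp
  · have h1 := swapMap_natural Δ[H] h.counit_moduleHom
    rw [unitAct, swapMap_unit (ComonObj.comul_counit H)] at h1
    have h2 : D.swap ≫ H ◁ D.counit = D.counit ▷ H ≫ (λ_ H).hom ≫ (ρ_ H).inv := h1.symm
    change (D.counit ⊗ₘ ε[H]) ≫ (λ_ (𝟙_ C)).hom = D.swap ≫ (ε[H] ⊗ₘ D.counit) ≫ (λ_ (𝟙_ C)).hom
    rw [MonoidalCategory.tensorHom_def' ε[H], Category.assoc, reassoc_of% h2,
      MonoidalCategory.tensorHom_def]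
    monoidal

/-- The comultiplication of `H ⋉ X` is multiplicative. By the universal property of the cross
product it suffices to treat `H` and `X` separately and to check that their images commute up to
`swap`. On `H` it is `h ↦ j(h₍₁₎) ⊗ j(h₍₂₎)`. On `X` it is the comultiplication of `X` followed by
the morphism on `X ⊗ X` that the universal property yields for the braiding of crossed modules. -/
theorem IsCrossedModuleBialgebra.isAlgebraHom_crossComul (h : D.IsCrossedModuleBialgebra)
    [MonObj (H ⊗ D.X)] (hm : μ[H ⊗ D.X] = D.crossMul) (he : η[H ⊗ D.X] = D.crossOne) :
    IsAlgebraHom D.crossMul D.crossOne μ[(H ⊗ D.X) ⊗ (H ⊗ D.X)] η[(H ⊗ D.X) ⊗ (H ⊗ D.X)]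
      D.crossComul := by
  have hs := h.isModuleAlgebra.isDistributiveLaw
  have hH : IsAlgebra μ[H] η[H] := ⟨inferInstance, rfl, rfl⟩
  have hj : IsAlgebraHom μ[H] η[H] μ[H ⊗ D.X] η[H ⊗ D.X] D.inj := by
    rw [hm, he]; exact hs.isAlgebraHom_twistInl h.isAlgebra
  -- `i` and `j = D.inj` are the inclusions of `X` and `H` in `B = H ⋉ X`.
  let i := twistInr D.X η[H]
  have hi : IsAlgebraHom D.mul D.one μ[H ⊗ D.X] η[H ⊗ D.X] i := by
    rw [hm, he]; exact hs.isAlgebraHom_twistInr hH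
  have hji : (D.inj ⊗ₘ i) ≫ μ[H ⊗ D.X] = 𝟙 _ := by
    rw [hm]; exact hs.twistInl_twistInr hH h.isAlgebra
  have hij : (i ⊗ₘ D.inj) ≫ μ[H ⊗ D.X] = swapMap Δ[H] D.act ≫ (D.inj ⊗ₘ i) ≫ μ[H ⊗ D.X] := by
    rw [hji, hm, Category.comp_id]; exact twistInr_twistInl hH h.isAlgebra
  -- The restriction of the comultiplication to `H`.
  have hu : IsAlgebraHom μ[H] η[H] μ[(H ⊗ D.X) ⊗ (H ⊗ D.X)] η[(H ⊗ D.X) ⊗ (H ⊗ D.X)]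
      (Δ[H] ≫ (D.inj ⊗ₘ D.inj)) :=
    IsAlgebraHom.comp ⟨by simp, by simp [MonObj.tensorObj.one_def]⟩ (hj.tensorHom hj)
  -- On `X ⊗ X`, with the braiding of crossed modules as twist: `x ⊗ y ↦ (x₍₀₎ ⊗ x₍₁₎)(1 ⊗ y)`.
  have hγ := h.isAlgebraHom_coact.comp (hi.tensorHom hj)
  have hφ := hγ.twist (isAlgebraHom_inSnd hi)
    (inSnd_commute_coact h.isCrossedModule.isRightComodule hij)
  -- The restriction of the comultiplication to `X`.
  have hv := IsAlgebraHom.comp h.comul_algebraHom hφ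
  -- The two restrictions commute up to `swap`.
  have hsv : ((D.comul ≫ ((D.coact ≫ (i ⊗ₘ D.inj)) ⊗ₘ inSnd i) ≫ μ) ⊗ₘ
        (Δ[H] ≫ (D.inj ⊗ₘ D.inj))) ≫ μ = D.swap ≫ ((Δ[H] ≫ (D.inj ⊗ₘ D.inj)) ⊗ₘ
        (D.comul ≫ ((D.coact ≫ (i ⊗ₘ D.inj)) ⊗ₘ inSnd i) ≫ μ)) ≫ μ := by
    have h1 := commute_mul (comul_commute_coact h.isCrossedModule hj hij)
      (comul_commute_inSnd hij)
    have h2 : D.comul ▷ H ≫ swapMap Δ[H] (diagAct D.act D.act) = D.swap ≫ H ◁ D.comul :=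
      swapMap_natural Δ[H] h.comul_moduleHom
    have h3 {Y : C} (w : D.X ⊗ D.X ⟶ Y) {Z : C} (z : H ⟶ Z) :
        (D.comul ≫ w) ⊗ₘ z = D.comul ▷ H ≫ (w ⊗ₘ z) := by
      rw [← tensorHom_id, tensorHom_comp_tensorHom, Category.id_comp]
    have h4 {Y : C} (w : D.X ⊗ D.X ⟶ Y) {Z : C} (z : H ⟶ Z) :
        z ⊗ₘ (D.comul ≫ w) = H ◁ D.comul ≫ (z ⊗ₘ w) := by
      rw [← id_tensorHom, tensorHom_comp_tensorHom, Category.id_comp]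
    rw [← swapMap_diagAct] at h1
    rw [h3, h4, Category.assoc, h1, Category.assoc, ← reassoc_of% h2]
  -- The comultiplication of `H ⋉ X` is the product of its two restrictions.
  have hΔ : D.crossComul = ((Δ[H] ≫ (D.inj ⊗ₘ D.inj)) ⊗ₘ
      (D.comul ≫ ((D.coact ≫ (i ⊗ₘ D.inj)) ⊗ₘ inSnd i) ≫ μ)) ≫ μ := by
    have h1 : (D.inj ⊗ₘ 𝟙 (H ⊗ D.X)) ≫ μ[H ⊗ D.X] = (α_ H H D.X).inv ≫ μ[H] ▷ D.X := by
      rw [hm, tensorHom_id]; exact hs.twistInl_whiskerRight h.isAlgebra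
    have h2 : (D.coact ≫ (i ⊗ₘ D.inj)) ⊗ₘ inSnd i =
        D.coact ▷ D.X ≫ ((i ⊗ₘ D.inj) ⊗ₘ inSnd i) := by
      rw [← tensorHom_id, tensorHom_comp_tensorHom, Category.id_comp]
    have h3 : (Δ[H] ≫ (D.inj ⊗ₘ D.inj)) ⊗ₘ
        (D.comul ≫ D.coact ▷ D.X ≫ (α_ D.X H D.X).hom ≫ (i ⊗ₘ 𝟙 (H ⊗ D.X))) =
        (Δ[H] ⊗ₘ (D.comul ≫ D.coact ▷ D.X ≫ (α_ D.X H D.X).hom)) ≫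
          ((D.inj ⊗ₘ D.inj) ⊗ₘ (i ⊗ₘ 𝟙 (H ⊗ D.X))) := by
      rw [tensorHom_comp_tensorHom]; simp only [Category.assoc]
    rw [h2, Category.assoc, mul_inSnd, hji, h3, Category.assoc, tensorHom_mul, hji, h1,
      crossComul, coswap, tensorμ, MonoidalCategory.tensorHom_def Δ[H],
      MonoidalCategory.tensorHom_def Δ[H]]
    monoidal
  rw [hΔ]
  exact hu.twist hv hsv

theorem IsCrossedModuleBialgebra.isAdmissible (h : D.IsCrossedModuleBialgebra) :
    D.IsAdmissible where
  isModuleAlgebra := h.isModuleAlgebra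
  isComoduleCoalgebra := h.isComoduleCoalgebra
  isBialgebra := by
    obtain ⟨sA, hm, he⟩ := h.isModuleAlgebra.isAlgebra_cross
    obtain ⟨sC, hd, hc⟩ := h.isComoduleCoalgebra.isCoalgebra_cross
    have h1 := h.isAlgebraHom_crossComul hm he
    have h2 := h.isAlgebraHom_crossCounit
    rw [← hm, ← he, ← hd] at h1
    rw [← hm, ← he, ← hc] at h2
    exact ⟨{ toMonObj := sA
             toComonObj := sC
             mul_comul := by rw [h1.map_mul, MonObj.tensorObj.mul_def]
             one_comul := h1.map_one
             mul_counit := h2.map_mul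
             one_counit := h2.map_one }, hm, he, hd, hc⟩

end CrossData

end

/-! ### Admissible pairs give crossed module bialgebras -/

section

variable {C : Type u} [Category.{v} C] [MonoidalCategory.{v} C] [BraidedCategory C]

namespace CrossData

variable {H : C} [BimonObj H] (D : CrossData H)

/-- The inclusion `x ↦ 1 ⊗ x` of `X` in `H ⋉ X`. -/
def inr : D.X ⟶ H ⊗ D.X := (λ_ D.X).inv ≫ η[H] ▷ D.X

/-- The projection `h ⊗ x ↦ ε(h) x` of `H ⋉ X` on `X`. -/
def projX : H ⊗ D.X ⟶ D.X := ε[H] ▷ D.X ≫ (λ_ D.X).hom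

theorem op_inr : D.op.inr = D.projX.op := rfl
theorem op_projX : D.op.projX = D.inr.op := rfl

theorem inr_projX : D.inr ≫ D.projX = 𝟙 _ := by
  simp [inr, projX, ← comp_whiskerRight_assoc]

theorem swap_projX : D.swap ≫ D.projX = D.act := by
  calc _ = 𝟙 _ ⊗≫ D.X ◁ Δ[H] ⊗≫ (β_ D.X H).hom ▷ H ⊗≫ (H ◁ D.act ≫ ε[H] ▷ D.X) ⊗≫ 𝟙 _ := by
        rw [swap, projX]; monoidal
    _ = 𝟙 _ ⊗≫ D.X ◁ Δ[H] ⊗≫ ((β_ D.X H).hom ≫ ε[H] ▷ D.X) ▷ H ⊗≫ D.act := by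
        rw [whisker_exchange]; monoidal
    _ = 𝟙 _ ⊗≫ D.X ◁ (Δ[H] ≫ ε[H] ▷ H) ⊗≫ D.act := by
        rw [← BraidedCategory.braiding_naturality_right, braiding_tensorUnit_right]; monoidal
    _ = _ := by
        rw [ComonObj.counit_comul]; monoidal

theorem crossMul_projX : D.crossMul ≫ D.projX = D.projX ▷ (H ⊗ D.X) ≫ D.crossAct := by
  calc _ = 𝟙 _ ⊗≫ H ◁ D.swap ▷ D.X ⊗≫ (H ⊗ H) ◁ D.mul ⊗≫ (μ[H] ≫ ε[H]) ▷ D.X ⊗≫ 𝟙 _ := by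
        rw [crossMul, projX, MonoidalCategory.tensorHom_def']; monoidal
    _ = 𝟙 _ ⊗≫ H ◁ D.swap ▷ D.X ⊗≫ (H ◁ (H ◁ D.mul ≫ ε[H] ▷ D.X)) ⊗≫ ε[H] ▷ D.X ⊗≫ 𝟙 _ := by
        rw [BimonObj.mul_counit, Comon.tensorObj_counit, MonoidalCategory.tensorHom_def']; monoidal
    _ = 𝟙 _ ⊗≫ (H ◁ ((D.swap ≫ D.projX) ▷ D.X ≫ D.mul) ≫ ε[H] ▷ D.X) ⊗≫ 𝟙 _ := by
        rw [whisker_exchange, projX]; monoidal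
    _ = _ := by
        rw [whisker_exchange, swap_projX, projX, crossAct]; monoidal

theorem inr_crossComul : D.inr ≫ D.crossComul = D.crossCoact ≫ D.inr ▷ (H ⊗ D.X) := by
  apply Quiver.Hom.op_inj
  have := D.op.crossMul_projX
  rw [op_crossMul, op_projX, op_crossAct] at this
  exact this

theorem inr_coswap : D.inr ≫ D.coswap = D.coact := by
  apply Quiver.Hom.op_inj
  have := D.op.swap_projX
  rwa [op_swap, op_projX] at this

variable {D}

theorem IsModuleAlgebra.inj_crossAct (h : D.IsModuleAlgebra) :
    D.X ◁ D.inj ≫ D.crossAct = D.act := by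
  obtain ⟨s, hm, he⟩ := h.isAlgebra
  have h1 := s.mul_one
  rw [hm, he] at h1
  calc _ = 𝟙 _ ⊗≫ ((D.X ⊗ H) ◁ D.one ≫ D.act ▷ D.X) ⊗≫ D.mul := by
        rw [inj, crossAct]; monoidal
    _ = 𝟙 _ ⊗≫ D.act ⊗≫ (D.X ◁ D.one ≫ D.mul) := by
        rw [whisker_exchange]; monoidal
    _ = _ := by rw [h1]; monoidal

theorem IsModuleAlgebra.inr_crossAct (h : D.IsModuleAlgebra) :
    D.X ◁ D.inr ≫ D.crossAct = D.mul := by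
  calc _ = 𝟙 _ ⊗≫ (D.X ◁ η[H] ≫ D.act) ▷ D.X ⊗≫ D.mul := by
        rw [inr, crossAct]; monoidal
    _ = _ := by rw [h.isRightModule.act_one]; monoidal

theorem IsModuleAlgebra.isAlgebraHom_inr (h : D.IsModuleAlgebra) :
    IsAlgebraHom D.mul D.one D.crossMul D.crossOne D.inr :=
  h.isDistributiveLaw.isAlgebraHom_twistInr ⟨inferInstance, rfl, rfl⟩

theorem IsModuleAlgebra.isAlgebraHom_inj (h : D.IsModuleAlgebra) :
    IsAlgebraHom μ[H] η[H] D.crossMul D.crossOne D.inj :=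
  h.isDistributiveLaw.isAlgebraHom_twistInl h.isAlgebra

theorem IsModuleAlgebra.inr_inj (h : D.IsModuleAlgebra) :
    (D.inr ⊗ₘ D.inj) ≫ D.crossMul = D.swap :=
  twistInr_twistInl ⟨inferInstance, rfl, rfl⟩ h.isAlgebra

theorem IsComoduleCoalgebra.projX_proj (h : D.IsComoduleCoalgebra) :
    D.crossComul ≫ (D.projX ⊗ₘ D.proj) = D.coswap := by
  apply Quiver.Hom.op_inj
  have := h.op.inr_inj
  rw [op_crossMul, op_inr, op_inj, op_swap] at this
  exact this

theorem IsComoduleCoalgebra.isCoalgebraHom_projX (h : D.IsComoduleCoalgebra) :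
    IsCoalgebraHom D.crossComul D.crossCounit D.comul D.counit D.projX := by
  have := h.op.isAlgebraHom_inr
  rw [op_crossMul, op_crossOne, op_inr] at this
  exact this.unop

theorem IsComoduleCoalgebra.isCoalgebraHom_proj (h : D.IsComoduleCoalgebra) :
    IsCoalgebraHom D.crossComul D.crossCounit Δ[H] ε[H] D.proj := by
  have := h.op.isAlgebraHom_inj
  rw [op_crossMul, op_crossOne, op_inj] at this
  exact this.unop

theorem inr_crossCounit : D.inr ≫ D.crossCounit = D.counit := by
  rw [inr, crossCounit, MonoidalCategory.tensorHom_def]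
  simp [← comp_whiskerRight_assoc]

theorem IsAdmissible.isAlgebraHom_crossCounit (h : D.IsAdmissible) :
    IsAlgebraHom D.crossMul D.crossOne (λ_ (𝟙_ C)).hom (𝟙 (𝟙_ C)) D.crossCounit := by
  obtain ⟨s, hm, he, hd, hc⟩ := h.isBialgebra
  have h1 := s.mul_counit
  have h2 := s.one_counit
  rw [← hm, ← he, ← hc]
  exact ⟨h1, h2⟩

theorem IsAdmissible.counit_algebraHom (h : D.IsAdmissible) :
    IsAlgebraHom D.mul D.one (λ_ (𝟙_ C)).hom (𝟙 (𝟙_ C)) D.counit := by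
  have h1 := h.isModuleAlgebra.isAlgebraHom_inr.comp h.isAlgebraHom_crossCounit
  rwa [inr_crossCounit] at h1

theorem IsAdmissible.counit_moduleHom (h : D.IsAdmissible) :
    IsModuleHom D.act (unitAct H) D.counit := by
  have h1 : D.swap ≫ D.crossCounit = D.act ≫ D.counit := by
    rw [crossCounit, MonoidalCategory.tensorHom_def, ← swap_projX, projX]
    monoidal
  have h2 : D.inj ≫ D.crossCounit = ε[H] := by
    have h2 := h.counit_algebraHom.map_one
    calc _ = 𝟙 _ ⊗≫ H ◁ (D.one ≫ D.counit) ⊗≫ ε[H] := by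
          rw [inj, crossCounit, MonoidalCategory.tensorHom_def']; monoidal
      _ = _ := by rw [h2]; monoidal
  unfold IsModuleHom
  rw [← h1, ← h.isModuleAlgebra.inr_inj, Category.assoc, h.isAlgebraHom_crossCounit.map_mul,
    tensorHom_comp_tensorHom_assoc, h2, inr_crossCounit, unitAct, MonoidalCategory.tensorHom_def]
  monoidal

/-- For an admissible pair, the counit of `X` is a morphism of module algebras because the counit of
`H ⋉ X` is an algebra morphism; hence so is the projection on `H`. -/
theorem IsAdmissible.isAlgebraHom_proj (h : D.IsAdmissible) :
    IsAlgebraHom D.crossMul D.crossOne μ[H] η[H] D.proj := by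
  have h1 : D.swap ≫ H ◁ D.counit = D.counit ▷ H ≫ (λ_ H).hom ≫ (ρ_ H).inv := by
    have h1 := swapMap_natural Δ[H] h.counit_moduleHom
    rw [unitAct, swapMap_unit (ComonObj.comul_counit H)] at h1
    exact h1.symm
  have h2 : (𝟙 H ⊗ₘ (D.counit ≫ η[H])) ≫ μ[H] = D.proj := by
    rw [id_tensorHom, MonoidalCategory.whiskerLeft_comp, Category.assoc, MonObj.mul_one, proj]
  have h3 : IsAlgebraHom D.mul D.one μ[H] η[H] (D.counit ≫ η[H]) :=
    h.counit_algebraHom.comp ⟨by simp [unitors_equal], by simp⟩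
  rw [← h2]
  refine IsAlgebraHom.twist (.id _ _) h3 ?_
  rw [h2, proj, reassoc_of% h1, tensorHom_id, comp_whiskerRight, Category.assoc, MonObj.one_mul]
  simp

theorem IsAdmissible.inj_proj (h : D.IsAdmissible) : D.inj ≫ D.proj = 𝟙 H := by
  have h2 := h.counit_algebraHom.map_one
  simp [inj, proj, ← MonoidalCategory.whiskerLeft_comp_assoc, h2]

theorem IsAdmissible.inj_crossComul (h : D.IsAdmissible) :
    D.inj ≫ D.crossComul = Δ[H] ≫ (D.inj ⊗ₘ D.inj) := by
  have hj := h.op.isAlgebraHom_proj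
  rw [op_crossMul, op_crossOne, op_proj] at hj
  exact hj.unop.map_comul

/-- The multiplicativity of the comultiplication of `H ⋉ X` on products `x · f`, `x` in `X`,
projected on `X` in the first tensor factor and along `q` in the second. The inclusions of `H` and
of `X` in the role of `f`, together with the projections on `H` and on `X` in the role of `q`,
give the conditions on `X`. -/
theorem IsAdmissible.inr_mul_comul_projX (h : D.IsAdmissible) {P P₁ P₂ Q Q' : C} {f : P ⟶ H ⊗ D.X}
    {d : P ⟶ P₁ ⊗ P₂} {f₁ : P₁ ⟶ H ⊗ D.X} {f₂ : P₂ ⟶ H ⊗ D.X} {q : H ⊗ D.X ⟶ Q}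
    {q' : H ⊗ D.X ⟶ Q'} {w : Q ⊗ Q' ⟶ Q} (hf : f ≫ D.crossComul = d ≫ (f₁ ⊗ₘ f₂))
    (hq : D.crossMul ≫ q = (q ⊗ₘ q') ≫ w) :
    (D.inr ⊗ₘ f) ≫ D.crossMul ≫ D.crossComul ≫ (D.projX ⊗ₘ q) =
      ((D.inr ≫ D.crossComul ≫ (D.projX ⊗ₘ q)) ⊗ₘ d) ≫ tensorμ D.X Q P₁ P₂ ≫
        ((D.X ◁ f₁ ≫ D.crossAct) ⊗ₘ (Q ◁ (f₂ ≫ q') ≫ w)) := by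
  obtain ⟨s, hm, he, hd, hc⟩ := h.isBialgebra
  have hB := s.mul_comul
  rw [hm, hd] at hB
  have h1 : D.crossMul ≫ D.projX = (D.projX ⊗ₘ 𝟙 _) ≫ D.crossAct := by
    rw [crossMul_projX, tensorHom_id]
  calc _ = ((D.inr ≫ D.crossComul) ⊗ₘ (f ≫ D.crossComul)) ≫ tensorμ _ _ _ _ ≫
            ((D.crossMul ≫ D.projX) ⊗ₘ (D.crossMul ≫ q)) := by
        rw [reassoc_of% hB, tensorHom_comp_tensorHom, tensorHom_comp_tensorHom_assoc]
    _ = (((D.inr ≫ D.crossComul) ⊗ₘ (d ≫ (f₁ ⊗ₘ f₂))) ≫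
          ((D.projX ⊗ₘ q) ⊗ₘ (𝟙 _ ⊗ₘ q'))) ≫ tensorμ _ _ _ _ ≫ (D.crossAct ⊗ₘ w) := by
        rw [h1, hq, hf, Category.assoc, tensorμ_natural_assoc, tensorHom_comp_tensorHom]
    _ = ((D.inr ≫ D.crossComul ≫ (D.projX ⊗ₘ q)) ⊗ₘ d) ≫
          ((𝟙 _ ⊗ₘ 𝟙 _) ⊗ₘ (f₁ ⊗ₘ (f₂ ≫ q'))) ≫ tensorμ _ _ _ _ ≫ (D.crossAct ⊗ₘ w) := by
        rw [tensorHom_comp_tensorHom, tensorHom_comp_tensorHom_assoc, Category.assoc,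
          Category.assoc, tensorHom_comp_tensorHom, Category.comp_id, id_tensorHom_id,
          Category.comp_id]
    _ = _ := by
        rw [tensorμ_natural_assoc, tensorHom_comp_tensorHom, id_tensorHom, id_tensorHom]

/-- The crossed module condition is the multiplicativity of the comultiplication of `H ⋉ X` on
`X ⊗ H`, projected on `X ⊗ H`. -/
theorem IsAdmissible.isCrossedModule (h : D.IsAdmissible) : IsCrossedModule D.act D.coact where
  isRightModule := h.isModuleAlgebra.isRightModule
  isRightComodule := h.isComoduleCoalgebra.isRightComodule
  compatibility := by
    calc _ = D.swap ≫ D.coswap := by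
          rw [swap, coswap]; simp only [Category.assoc, MonoidalCategory.whiskerLeft_comp]
      _ = (D.inr ⊗ₘ D.inj) ≫ D.crossMul ≫ D.crossComul ≫ (D.projX ⊗ₘ D.proj) := by
          rw [← h.isModuleAlgebra.inr_inj, ← h.isComoduleCoalgebra.projX_proj]
          simp only [Category.assoc]
      _ = _ := by
          rw [h.inr_mul_comul_projX h.inj_crossComul h.isAlgebraHom_proj.map_mul,
            h.isComoduleCoalgebra.projX_proj, inr_coswap, h.isModuleAlgebra.inj_crossAct,
            h.inj_proj]
          simp

/-- The `H`-linearity of the comultiplication of `X` is the multiplicativity of the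
comultiplication of `H ⋉ X` on `X ⊗ H`, projected on `X ⊗ X`. -/
theorem IsAdmissible.comul_moduleHom (h : D.IsAdmissible) :
    IsModuleHom D.act (diagAct D.act D.act) D.comul := by
  have h1 : D.crossMul ≫ D.projX = (D.projX ⊗ₘ 𝟙 _) ≫ D.crossAct := by
    rw [crossMul_projX, tensorHom_id]
  have h2 := h.inr_mul_comul_projX h.inj_crossComul h1
  rw [← h.isComoduleCoalgebra.isCoalgebraHom_projX.map_comul, ← Category.assoc,
    h.isModuleAlgebra.inr_inj, reassoc_of% D.swap_projX, reassoc_of% D.inr_projX, Category.comp_id,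
    h.isModuleAlgebra.inj_crossAct] at h2
  unfold IsModuleHom
  rw [h2, MonoidalCategory.tensorHom_def, Category.assoc, diagAct]

/-- The bialgebra condition on `X` is the multiplicativity of the comultiplication of `H ⋉ X` on
`X ⊗ X`, projected on `X ⊗ X`. -/
theorem IsAdmissible.comul_map_mul (h : D.IsAdmissible) :
    D.mul ≫ D.comul = (D.comul ⊗ₘ D.comul) ≫
      twistMul D.mul D.mul (crossedBraiding D.act D.coact) := by
  have h1 : D.crossMul ≫ D.projX = (D.projX ⊗ₘ 𝟙 _) ≫ D.crossAct := by
    rw [crossMul_projX, tensorHom_id]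
  have h3 : D.inr ≫ D.crossComul = D.crossCoact ≫ (D.inr ⊗ₘ 𝟙 _) := by
    rw [inr_crossComul, tensorHom_id]
  have h2 := h.inr_mul_comul_projX h3 h1
  rw [← h.isComoduleCoalgebra.isCoalgebraHom_projX.map_comul, ← Category.assoc,
    ← h.isModuleAlgebra.isAlgebraHom_inr.map_mul, Category.assoc, reassoc_of% D.inr_projX,
    Category.comp_id, h.isModuleAlgebra.inr_crossAct] at h2
  rw [h2]
  calc _ = 𝟙 _ ⊗≫ (D.comul ⊗ₘ D.comul) ⊗≫ D.X ◁ (D.X ◁ D.coact ⊗≫ (β_ D.X D.X).hom ▷ H) ▷ D.X ⊗≫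
          (D.mul ▷ ((D.X ⊗ H) ⊗ D.X) ≫ D.X ◁ (D.act ▷ D.X ≫ D.mul)) := by
        rw [crossAct, crossCoact, tensorμ, MonoidalCategory.tensorHom_def,
          MonoidalCategory.tensorHom_def, MonoidalCategory.tensorHom_def]
        monoidal
    _ = _ := by
        rw [← whisker_exchange, twistMul, crossedBraiding, MonoidalCategory.tensorHom_def' D.mul]
        monoidal

theorem IsAdmissible.isCrossedModuleBialgebra (h : D.IsAdmissible) :
    D.IsCrossedModuleBialgebra where
  isCrossedModule := h.isCrossedModule
  isAlgebra := h.isModuleAlgebra.isAlgebra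
  isCoalgebra := h.isComoduleCoalgebra.isCoalgebra
  mul_moduleHom := h.isModuleAlgebra.mul_hom
  mul_comoduleHom := by
    have := h.op.comul_moduleHom
    refine IsModuleHom.unop ?_
    rwa [← diagAct_op]
  one_moduleHom := h.isModuleAlgebra.one_hom
  one_comoduleHom := by
    have := h.op.counit_moduleHom
    refine IsModuleHom.unop ?_
    rwa [← unitAct_op]
  comul_moduleHom := h.comul_moduleHom
  comul_comoduleHom := h.isComoduleCoalgebra.comul_hom
  counit_moduleHom := h.counit_moduleHom
  counit_comoduleHom := h.isComoduleCoalgebra.counit_hom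
  comul_algebraHom :=
    { map_mul := h.comul_map_mul
      map_one := by
        have := h.op.counit_algebraHom.map_mul
        apply Quiver.Hom.op_inj
        refine this.trans ?_
        simp [CrossData.op] }
  counit_algebraHom := h.counit_algebraHom

end CrossData

end

/-! ### Transport of structure along isomorphisms -/

section

variable {C : Type u} [Category.{v} C] [MonoidalCategory.{v} C]

theorem IsAlgebraHom.isAlgebra_of_isIso {A B : C} {m : A ⊗ A ⟶ A} {e : 𝟙_ C ⟶ A}
    {m' : B ⊗ B ⟶ B} {e' : 𝟙_ C ⟶ B} {f : A ⟶ B} [IsIso f] (hf : IsAlgebraHom m e m' e' f)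
    (h : IsAlgebra m' e') : IsAlgebra m e := by
  obtain ⟨s, rfl, rfl⟩ := h
  have h1 := hf.map_mul
  have h2 := hf.map_one
  refine ⟨MonObj.ofIso (asIso f).symm, ?_, ?_⟩
  · change (f ⊗ₘ f) ≫ μ[B] ≫ inv f = m
    rw [← reassoc_of% h1]; simp
  · change η[B] ≫ inv f = e
    rw [← h2]; simp

theorem IsCoalgebraHom.isCoalgebra_of_isIso {A B : C} {d : A ⟶ A ⊗ A} {c : A ⟶ 𝟙_ C}
    {d' : B ⟶ B ⊗ B} {c' : B ⟶ 𝟙_ C} {f : A ⟶ B} [IsIso f] (hf : IsCoalgebraHom d c d' c' f)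
    (h : IsCoalgebra d' c') :
    IsCoalgebra d c := by
  apply IsAlgebra.unop
  have h1 : IsAlgebraHom (C := Cᵒᵖ) d'.op c'.op d.op c.op f.op :=
    ⟨congrArg Quiver.Hom.op hf.map_comul, congrArg Quiver.Hom.op hf.map_counit⟩
  have h2 : IsAlgebraHom (C := Cᵒᵖ) d.op c.op d'.op c'.op (inv f.op) :=
    ⟨by rw [IsIso.comp_inv_eq, Category.assoc, h1.map_mul, tensorHom_comp_tensorHom_assoc]; simp,
      by rw [IsIso.comp_inv_eq, h1.map_one]⟩
  exact h2.isAlgebra_of_isIso h.op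

theorem IsRightModule.of_isIso {H X Y : C} [MonObj H] {a : X ⊗ H ⟶ X} {b : Y ⊗ H ⟶ Y} {f : X ⟶ Y}
    [IsIso f] (hf : IsModuleHom a b f) (h : IsRightModule b) : IsRightModule a := by
  unfold IsModuleHom at hf
  constructor
  · rw [← cancel_mono f, Category.assoc, hf, whisker_exchange_assoc, h.act_one]
    simp
  · rw [← cancel_mono f]
    simp only [Category.assoc]
    rw [hf, whisker_exchange_assoc, h.act_mul, ← comp_whiskerRight_assoc, hf]
    simp

theorem IsRightComodule.of_isIso {H X Y : C} [ComonObj H] {a : X ⟶ X ⊗ H} {b : Y ⟶ Y ⊗ H}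
    {f : X ⟶ Y} [IsIso f] (hf : IsComoduleHom a b f) (h : IsRightComodule b) :
    IsRightComodule a := by
  unfold IsComoduleHom at hf
  constructor
  · rw [← cancel_mono (f ▷ 𝟙_ C), Category.assoc, whisker_exchange, ← reassoc_of% hf,
      h.coact_counit]
    simp
  · rw [← cancel_mono (f ▷ (H ⊗ H))]
    simp only [Category.assoc]
    rw [whisker_exchange, ← reassoc_of% hf, h.coact_comul, ← associator_naturality_left,
      ← comp_whiskerRight_assoc, ← hf, comp_whiskerRight_assoc, reassoc_of% hf]

theorem IsModuleHom.of_isIso {H X X' Y Y' : C} {a : X ⊗ H ⟶ X} {a' : X' ⊗ H ⟶ X'}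
    {b : Y ⊗ H ⟶ Y} {b' : Y' ⊗ H ⟶ Y'} {f : X ⟶ X'} {g : Y ⟶ Y'} [IsIso g]
    {k : X ⟶ Y} {k' : X' ⟶ Y'}
    (hf : IsModuleHom a a' f) (hg : IsModuleHom b b' g) (hk : k ≫ g = f ≫ k')
    (h : IsModuleHom a' b' k') : IsModuleHom a b k := by
  unfold IsModuleHom at *
  rw [← cancel_mono g, Category.assoc, hk, reassoc_of% hf, h, Category.assoc, hg,
    ← comp_whiskerRight_assoc, ← hk, comp_whiskerRight_assoc]

theorem IsComoduleHom.of_isIso {H X X' Y Y' : C} {a : X ⟶ X ⊗ H} {a' : X' ⟶ X' ⊗ H}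
    {b : Y ⟶ Y ⊗ H} {b' : Y' ⟶ Y' ⊗ H} {f : X ⟶ X'} {g : Y ⟶ Y'} [IsIso g]
    {k : X ⟶ Y} {k' : X' ⟶ Y'}
    (hf : IsComoduleHom a a' f) (hg : IsComoduleHom b b' g) (hk : k ≫ g = f ≫ k')
    (h : IsComoduleHom a' b' k') : IsComoduleHom a b k := by
  unfold IsComoduleHom at *
  rw [← cancel_mono (g ▷ H), Category.assoc, ← hg, reassoc_of% hk, h, reassoc_of% hf,
    Category.assoc, ← comp_whiskerRight, ← comp_whiskerRight, hk]

variable [BraidedCategory C]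

theorem IsModuleHom.tensorHom {H X X' Y Y' : C} [ComonObj H] {a : X ⊗ H ⟶ X} {a' : X' ⊗ H ⟶ X'}
    {b : Y ⊗ H ⟶ Y} {b' : Y' ⊗ H ⟶ Y'} {f : X ⟶ X'} {g : Y ⟶ Y'} (hf : IsModuleHom a a' f)
    (hg : IsModuleHom b b' g) : IsModuleHom (diagAct a b) (diagAct a' b') (f ⊗ₘ g) := by
  unfold IsModuleHom at *
  rw [diagAct, diagAct, ← whisker_exchange_assoc, tensorμ_natural_left_assoc]
  simp only [Category.assoc, tensorHom_comp_tensorHom, hf, hg]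

theorem IsComoduleHom.tensorHom {H X X' Y Y' : C} [MonObj H] {a : X ⟶ X ⊗ H} {a' : X' ⟶ X' ⊗ H}
    {b : Y ⟶ Y ⊗ H} {b' : Y' ⟶ Y' ⊗ H} {f : X ⟶ X'} {g : Y ⟶ Y'} (hf : IsComoduleHom a a' f)
    (hg : IsComoduleHom b b' g) : IsComoduleHom (diagCoact a b) (diagCoact a' b') (f ⊗ₘ g) := by
  unfold IsComoduleHom at *
  rw [diagCoact, diagCoact, tensorHom_comp_tensorHom_assoc, hf, hg,
    ← tensorHom_comp_tensorHom_assoc,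
    ← tensorHom_id, ← tensorHom_id, tensorμ_natural_assoc, id_tensorHom_id, tensorHom_id,
    ← whisker_exchange]
  simp only [Category.assoc]

theorem IsCrossedModule.of_isIso {H X Y : C} [BimonObj H] {a : X ⊗ H ⟶ X} {b : Y ⊗ H ⟶ Y}
    {c : X ⟶ X ⊗ H} {d : Y ⟶ Y ⊗ H} {f : X ⟶ Y} [IsIso f] (hf : IsModuleHom a b f)
    (hf' : IsComoduleHom c d f) (h : IsCrossedModule b d) : IsCrossedModule a c where
  isRightModule := h.isRightModule.of_isIso hf
  isRightComodule := h.isRightComodule.of_isIso hf'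
  compatibility := by
    have h1 := h.compatibility
    unfold IsModuleHom at hf
    unfold IsComoduleHom at hf'
    have h2 : f ▷ H ≫ Y ◁ Δ[H] ≫ (α_ Y H H).inv ≫ (β_ Y H).hom ▷ H ≫ (α_ H Y H).hom ≫ H ◁ b =
        (X ◁ Δ[H] ≫ (α_ X H H).inv ≫ (β_ X H).hom ▷ H ≫ (α_ H X H).hom ≫ H ◁ a) ≫ H ◁ f :=
      swapMap_natural Δ[H] hf
    have h3 : ((α_ H X H).inv ≫ (β_ H X).hom ▷ H ≫ (α_ X H H).hom ≫ X ◁ μ[H]) ≫ f ▷ H =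
        H ◁ (f ▷ H) ≫ (α_ H Y H).inv ≫ (β_ H Y).hom ▷ H ≫ (α_ Y H H).hom ≫ Y ◁ μ[H] := by
      simp only [Category.assoc]
      rw [whisker_exchange, ← associator_naturality_left_assoc, ← comp_whiskerRight_assoc,
        ← BraidedCategory.braiding_naturality_right, comp_whiskerRight_assoc,
        associator_inv_naturality_middle_assoc]
    rw [← cancel_mono (f ▷ H)]
    calc _ = X ◁ Δ[H] ≫ (α_ X H H).inv ≫ (β_ X H).hom ▷ H ≫ (α_ H X H).hom ≫ H ◁ a ≫
          H ◁ c ≫ ((α_ H X H).inv ≫ (β_ H X).hom ▷ H ≫ (α_ X H H).hom ≫ X ◁ μ[H]) ≫ f ▷ H := by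
          simp only [Category.assoc, MonoidalCategory.whiskerLeft_comp]
      _ = (f ▷ H ≫ Y ◁ Δ[H] ≫ (α_ Y H H).inv ≫ (β_ Y H).hom ▷ H ≫ (α_ H Y H).hom ≫ H ◁ b) ≫
          H ◁ d ≫ (α_ H Y H).inv ≫ (β_ H Y).hom ▷ H ≫ (α_ Y H H).hom ≫ Y ◁ μ[H] := by
          rw [h2, h3, ← MonoidalCategory.whiskerLeft_comp_assoc H c, ← hf']
          simp only [Category.assoc, MonoidalCategory.whiskerLeft_comp]
      _ = f ▷ H ≫ (d ⊗ₘ Δ[H]) ≫ tensorμ Y H H H ≫ (b ⊗ₘ μ[H]) := by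
          rw [← h1]
          simp only [Category.assoc, MonoidalCategory.whiskerLeft_comp]
      _ = (c ⊗ₘ Δ[H]) ≫ ((f ⊗ₘ 𝟙 H) ⊗ₘ (𝟙 H ⊗ₘ 𝟙 H)) ≫ tensorμ Y H H H ≫ (b ⊗ₘ μ[H]) := by
          rw [← tensorHom_id, tensorHom_comp_tensorHom_assoc, tensorHom_comp_tensorHom_assoc, hf']
          simp
      _ = _ := by
          rw [tensorμ_natural_assoc, tensorHom_comp_tensorHom, tensorHom_id, ← hf,
            id_tensorHom_id, Category.id_comp, Category.assoc, Category.assoc, ← tensorHom_id,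
            tensorHom_comp_tensorHom, Category.comp_id]

theorem crossedBraiding_natural {H X X' Y Y' : C} {a : X ⊗ H ⟶ X} {a' : X' ⊗ H ⟶ X'}
    {c : Y ⟶ Y ⊗ H} {c' : Y' ⟶ Y' ⊗ H} {f : X ⟶ X'} {g : Y ⟶ Y'} (hf : IsModuleHom a a' f)
    (hg : IsComoduleHom c c' g) :
    crossedBraiding a c ≫ (g ⊗ₘ f) = (f ⊗ₘ g) ≫ crossedBraiding a' c' := by
  unfold IsModuleHom at hf
  unfold IsComoduleHom at hg
  calc _ = 𝟙 _ ⊗≫ X ◁ c ⊗≫ (β_ X Y).hom ▷ H ⊗≫ Y ◁ (a ≫ f) ⊗≫ g ▷ X' := by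
        rw [crossedBraiding, MonoidalCategory.tensorHom_def']; monoidal
    _ = 𝟙 _ ⊗≫ X ◁ c ⊗≫ ((β_ X Y).hom ≫ Y ◁ f) ▷ H ⊗≫ (Y ◁ a' ≫ g ▷ X') := by
        rw [hf]; monoidal
    _ = 𝟙 _ ⊗≫ (X ◁ c ≫ f ▷ (Y ⊗ H)) ⊗≫ ((β_ X' Y).hom ≫ g ▷ X') ▷ H ⊗≫ Y' ◁ a' := by
        rw [← BraidedCategory.braiding_naturality_left, whisker_exchange]; monoidal
    _ = 𝟙 _ ⊗≫ f ▷ Y ⊗≫ X' ◁ (c ≫ g ▷ H) ⊗≫ (β_ X' Y').hom ▷ H ⊗≫ Y' ◁ a' := by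
        rw [← BraidedCategory.braiding_naturality_right, whisker_exchange]; monoidal
    _ = _ := by
        rw [← hg, crossedBraiding, MonoidalCategory.tensorHom_def]; monoidal

namespace CrossData

variable {H : C} [BimonObj H] {D E : CrossData H}

/-- The structure of a crossed module bialgebra is transported along an isomorphism that respects
all structure morphisms. -/
theorem IsCrossedModuleBialgebra.of_isIso {f : D.X ⟶ E.X} [IsIso f]
    (hf : IsCrossedModuleBialgebraHom D E f) (h : E.IsCrossedModuleBialgebra) :
    D.IsCrossedModuleBialgebra where
  isCrossedModule := h.isCrossedModule.of_isIso hf.isModuleHom hf.isComoduleHom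
  isAlgebra := hf.isAlgebraHom.isAlgebra_of_isIso h.isAlgebra
  isCoalgebra := hf.isCoalgebraHom.isCoalgebra_of_isIso h.isCoalgebra
  mul_moduleHom := .of_isIso (hf.isModuleHom.tensorHom hf.isModuleHom) hf.isModuleHom
    hf.isAlgebraHom.map_mul h.mul_moduleHom
  mul_comoduleHom := .of_isIso (hf.isComoduleHom.tensorHom hf.isComoduleHom) hf.isComoduleHom
    hf.isAlgebraHom.map_mul h.mul_comoduleHom
  one_moduleHom := .of_isIso (f := 𝟙 _) (by simp [IsModuleHom]) hf.isModuleHom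
    (by rw [hf.isAlgebraHom.map_one, Category.id_comp]) h.one_moduleHom
  one_comoduleHom := .of_isIso (f := 𝟙 _) (by simp [IsComoduleHom]) hf.isComoduleHom
    (by rw [hf.isAlgebraHom.map_one, Category.id_comp]) h.one_comoduleHom
  comul_moduleHom := .of_isIso hf.isModuleHom (hf.isModuleHom.tensorHom hf.isModuleHom)
    hf.isCoalgebraHom.map_comul.symm h.comul_moduleHom
  comul_comoduleHom := .of_isIso hf.isComoduleHom (hf.isComoduleHom.tensorHom hf.isComoduleHom)
    hf.isCoalgebraHom.map_comul.symm h.comul_comoduleHom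
  counit_moduleHom := .of_isIso (g := 𝟙 _) hf.isModuleHom (by simp [IsModuleHom])
    (by rw [hf.isCoalgebraHom.map_counit, Category.comp_id]) h.counit_moduleHom
  counit_comoduleHom := .of_isIso (g := 𝟙 _) hf.isComoduleHom (by simp [IsComoduleHom])
    (by rw [hf.isCoalgebraHom.map_counit, Category.comp_id]) h.counit_comoduleHom
  comul_algebraHom :=
    { map_mul := by
        have h1 : E.mul ≫ E.comul = (E.comul ⊗ₘ E.comul) ≫
            twistMul E.mul E.mul (crossedBraiding E.act E.coact) := h.comul_algebraHom.map_mul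
        have h2 := twistMul_natural hf.isAlgebraHom.map_mul hf.isAlgebraHom.map_mul
          (crossedBraiding_natural hf.isModuleHom hf.isComoduleHom)
        change _ = (D.comul ⊗ₘ D.comul) ≫ twistMul D.mul D.mul (crossedBraiding D.act D.coact)
        rw [← cancel_mono (f ⊗ₘ f), Category.assoc, Category.assoc, h2,
          ← hf.isCoalgebraHom.map_comul, reassoc_of% hf.isAlgebraHom.map_mul, h1,
          tensorHom_comp_tensorHom_assoc, tensorHom_comp_tensorHom_assoc,
          hf.isCoalgebraHom.map_comul]
      map_one := by
        have h1 := h.comul_algebraHom.map_one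
        rw [← cancel_mono (f ⊗ₘ f), Category.assoc, ← hf.isCoalgebraHom.map_comul,
          reassoc_of% hf.isAlgebraHom.map_one, h1, Category.assoc, tensorHom_comp_tensorHom,
          hf.isAlgebraHom.map_one] }
  counit_algebraHom :=
    { map_mul := by
        rw [← hf.isCoalgebraHom.map_counit, reassoc_of% hf.isAlgebraHom.map_mul,
          h.counit_algebraHom.map_mul, tensorHom_comp_tensorHom_assoc]
      map_one := by
        rw [← hf.isCoalgebraHom.map_counit, reassoc_of% hf.isAlgebraHom.map_one,
          h.counit_algebraHom.map_one] }

end CrossData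

end

/-! ### Morphisms -/

section

variable {C : Type u} [Category.{v} C] [MonoidalCategory.{v} C] [BraidedCategory C]

namespace CrossData

section

variable {H : C} [BimonObj H] {D E : CrossData H}

theorem isAlgebraHom_whiskerLeft {f : D.X ⟶ E.X}
    (hf : IsAlgebraHom D.mul D.one E.mul E.one f) (hf' : IsModuleHom D.act E.act f) :
    IsAlgebraHom D.crossMul D.crossOne E.crossMul E.crossOne (H ◁ f) := by
  have hs : D.swap ≫ H ◁ f = f ▷ H ≫ E.swap := (swapMap_natural Δ[H] hf').symm
  constructor
  · rw [← id_tensorHom]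
    exact twistMul_natural (by simp) hf.map_mul (by rw [id_tensorHom, tensorHom_id, hs])
  · rw [crossOne, crossOne, ← hf.map_one, Category.assoc, ← id_tensorHom, tensorHom_comp_tensorHom,
      Category.comp_id]

theorem whiskerLeft_projX (f : D.X ⟶ E.X) : H ◁ f ≫ E.projX = D.projX ≫ f := by
  rw [projX, projX, whisker_exchange_assoc]
  simp

theorem IsCrossedModuleBialgebraHom.isAdmissibleHom {f : D.X ⟶ E.X}
    (hf : IsCrossedModuleBialgebraHom D E f) :
    IsAdmissibleHom D E (H ◁ f) where
  isAlgebraHom := isAlgebraHom_whiskerLeft hf.isAlgebraHom hf.isModuleHom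
  isCoalgebraHom := by
    have := isAlgebraHom_whiskerLeft (D := E.op) (E := D.op) hf.isCoalgebraHom.op
      hf.isComoduleHom.op
    rw [op_crossMul, op_crossMul, op_crossOne, op_crossOne] at this
    exact this.unop
  inj_comp := by
    rw [inj, inj, Category.assoc, ← MonoidalCategory.whiskerLeft_comp, hf.isAlgebraHom.map_one]
  comp_proj := by
    rw [proj, proj, ← MonoidalCategory.whiskerLeft_comp_assoc, hf.isCoalgebraHom.map_counit]

/-- A morphism of admissible pairs that restricts and projects to `f` on `X` makes `f` a morphism of
crossed module bialgebras. -/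
theorem IsAdmissibleHom.isCrossedModuleBialgebraHom {h : H ⊗ D.X ⟶ H ⊗ E.X}
    (hD : D.IsAdmissible) (hE : E.IsAdmissible) (hh : IsAdmissibleHom D E h) {f : D.X ⟶ E.X}
    (hf : D.inr ≫ h = f ≫ E.inr) (hf' : h ≫ E.projX = D.projX ≫ f) :
    IsCrossedModuleBialgebraHom D E f := by
  have hfe : f = D.inr ≫ h ≫ E.projX := by
    rw [reassoc_of% hf, inr_projX, Category.comp_id]
  have h1 := hD.isModuleAlgebra.isAlgebraHom_inr.comp hh.isAlgebraHom
  have h2 := hh.isCoalgebraHom.comp hE.isComoduleCoalgebra.isCoalgebraHom_projX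
  have h3 := hE.isModuleAlgebra.isAlgebraHom_inr
  have h4 := hD.isComoduleCoalgebra.isCoalgebraHom_projX
  rw [hf] at h1
  rw [hf'] at h2
  refine ⟨?_, ?_, ⟨?_, ?_⟩, ⟨?_, ?_⟩⟩
  · unfold IsModuleHom
    rw [← swap_projX, ← swap_projX, ← hD.isModuleAlgebra.inr_inj, ← hE.isModuleAlgebra.inr_inj]
    simp only [Category.assoc]
    rw [← hf', reassoc_of% hh.isAlgebraHom.map_mul, tensorHom_comp_tensorHom_assoc, hf,
      hh.inj_comp, ← tensorHom_id, tensorHom_comp_tensorHom_assoc, Category.id_comp]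
  · unfold IsComoduleHom
    rw [← inr_coswap, ← inr_coswap, ← hD.isComoduleCoalgebra.projX_proj,
      ← hE.isComoduleCoalgebra.projX_proj]
    simp only [Category.assoc]
    rw [← reassoc_of% hf, reassoc_of% hh.isCoalgebraHom.map_comul, tensorHom_comp_tensorHom, hf',
      hh.comp_proj, ← tensorHom_id, tensorHom_comp_tensorHom, Category.comp_id]
  · have h5 := congrArg (· ≫ E.projX) h1.map_mul
    simp only [← tensorHom_comp_tensorHom, ← h3.map_mul, Category.assoc, inr_projX,
      Category.comp_id] at h5
    exact h5
  · have h5 := congrArg (· ≫ E.projX) h1.map_one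
    simp only [← h3.map_one, Category.assoc, inr_projX, Category.comp_id] at h5
    exact h5
  · have h5 := congrArg (D.inr ≫ ·) h2.map_comul
    simp only [← tensorHom_comp_tensorHom, ← reassoc_of% h4.map_comul, Category.assoc,
      reassoc_of% D.inr_projX] at h5
    exact h5
  · have h5 := congrArg (D.inr ≫ ·) h2.map_counit
    simp only [← h4.map_counit, Category.assoc, reassoc_of% D.inr_projX] at h5
    exact h5

end
end CrossData

section

variable {H : C} [HopfObj H]
open AdmissiblePair

/-- A morphism of admissible pairs maps `X` into `Y`: it commutes with the idempotents `Π`, and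
`X` is the image of `Π`. Here the antipode is used. -/
theorem inr_comp {A B : AdmissiblePair H} (h : A ⟶ B) :
    A.data.inr ≫ h.hom = (A.data.inr ≫ h.hom ≫ B.data.projX) ≫ B.data.inr := by
  have h1 : A.data.projX ≫ A.data.inr = A.idem := (canonicalSplitting A).p_i
  have h2 : B.data.projX ≫ B.data.inr = B.idem := (canonicalSplitting B).p_i
  rw [Category.assoc, Category.assoc, h2, ← idem_natural, ← h1, Category.assoc,
    reassoc_of% A.data.inr_projX]

/-- A morphism of admissible pairs is determined by its restriction to `X`, since
`h ⊗ x = (h ⊗ 1)(1 ⊗ x)`. -/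
theorem hom_eq_whiskerLeft {A B : AdmissiblePair H} (h : A ⟶ B) :
    h.hom = H ◁ (A.data.inr ≫ h.hom ≫ B.data.projX) := by
  have hH : IsAlgebra μ[H] η[H] := ⟨inferInstance, rfl, rfl⟩
  have hA : (A.data.inj ⊗ₘ A.data.inr) ≫ A.data.crossMul = 𝟙 _ :=
    A.property.isModuleAlgebra.isDistributiveLaw.twistInl_twistInr hH
      A.property.isModuleAlgebra.isAlgebra
  have hB : (B.data.inj ⊗ₘ B.data.inr) ≫ B.data.crossMul = 𝟙 _ :=
    B.property.isModuleAlgebra.isDistributiveLaw.twistInl_twistInr hH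
      B.property.isModuleAlgebra.isAlgebra
  calc h.hom = ((A.data.inj ⊗ₘ A.data.inr) ≫ A.data.crossMul) ≫ h.hom := by
        rw [hA, Category.id_comp]
    _ = (B.data.inj ⊗ₘ ((A.data.inr ≫ h.hom ≫ B.data.projX) ≫ B.data.inr)) ≫ B.data.crossMul := by
        rw [Category.assoc, h.property.isAlgebraHom.map_mul, tensorHom_comp_tensorHom_assoc,
          h.property.inj_comp, ← inr_comp]
    _ = _ := by
        rw [← Category.id_comp B.data.inj, ← tensorHom_comp_tensorHom, Category.assoc, hB,
          Category.comp_id, id_tensorHom]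

theorem comp_projX {A B : AdmissiblePair H} (h : A ⟶ B) :
    h.hom ≫ B.data.projX = A.data.projX ≫ A.data.inr ≫ h.hom ≫ B.data.projX := by
  conv_lhs => rw [hom_eq_whiskerLeft h]
  rw [CrossData.whiskerLeft_projX]

end

end

/-! ### Coinvariants and the isomorphism of categories -/

section

/-- If the identity respects all structure morphisms, then these agree. The two data have the same
underlying object definitionally, so that no transport along an equality of objects occurs. -/
theorem CrossData.eq_of_isCrossedModuleBialgebraHom_id {C : Type u} [Category.{v} C]
    [MonoidalCategory.{v} C] {H X : C} {m m' : X ⊗ X ⟶ X} {e e' : 𝟙_ C ⟶ X} {d d' : X ⟶ X ⊗ X}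
    {c c' : X ⟶ 𝟙_ C} {a a' : X ⊗ H ⟶ X} {b b' : X ⟶ X ⊗ H}
    (h : IsCrossedModuleBialgebraHom ⟨X, m, e, d, c, a, b⟩ ⟨X, m', e', d', c', a', b'⟩ (𝟙 X)) :
    CrossData.mk X m e d c a b = ⟨X, m', e', d', c', a', b'⟩ := by
  obtain ⟨h1, h2, ⟨h3, h4⟩, ⟨h5, h6⟩⟩ := h
  simp only [IsModuleHom, IsComoduleHom, Category.comp_id, Category.id_comp, id_whiskerRight,
    id_tensorHom_id] at h1 h2 h3 h4 h5 h6
  subst h1 h2 h3 h4 h5 h6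
  rfl

variable {C : Type u} [Category.{v} C] [MonoidalCategory.{v} C] [BraidedCategory C]

theorem CrossedModuleBialgebra.isIso_of_isIso {H : C} [BimonObj H] {A B : CrossedModuleBialgebra H}
    (f : A ⟶ B) [IsIso f.hom] : IsIso f := by
  have hf := f.property
  have h1 := hf.isModuleHom
  have h2 := hf.isComoduleHom
  unfold IsModuleHom at h1
  unfold IsComoduleHom at h2
  refine ⟨⟨inv f.hom, ?_, ?_, ⟨?_, ?_⟩, ⟨?_, ?_⟩⟩, Hom.ext (IsIso.hom_inv_id f.hom),
    Hom.ext (IsIso.inv_hom_id f.hom)⟩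
  · unfold IsModuleHom
    rw [IsIso.comp_inv_eq, Category.assoc, h1, ← comp_whiskerRight_assoc]
    simp
  · unfold IsComoduleHom
    rw [IsIso.inv_comp_eq, reassoc_of% h2, ← comp_whiskerRight]
    simp
  · rw [IsIso.comp_inv_eq, Category.assoc, hf.isAlgebraHom.map_mul, tensorHom_comp_tensorHom_assoc]
    simp
  · rw [IsIso.comp_inv_eq, hf.isAlgebraHom.map_one]
  · rw [IsIso.inv_comp_eq, reassoc_of% hf.isCoalgebraHom.map_comul, tensorHom_comp_tensorHom]
    simp
  · rw [IsIso.inv_comp_eq, hf.isCoalgebraHom.map_counit]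

variable {H : C} [HopfObj H]

/-- The idempotent `Π` is the projection on `X` followed by the inclusion of `X`. -/
theorem projX_inr (A : AdmissiblePair H) : A.data.projX ≫ A.data.inr = A.idem :=
  (AdmissiblePair.canonicalSplitting A).p_i

theorem IdempotentSplitting.i_e {C : Type u} [Category.{v} C] {X : C} {e : X ⟶ X}
    (s : IdempotentSplitting e) : s.i ≫ e = s.i := by
  have h : s.i ≫ s.p ≫ s.i = s.i := by rw [reassoc_of% s.i_p]
  exact (congrArg (s.i ≫ ·) s.p_i).symm.trans h

theorem splitting_i_projX_inr (A : AdmissiblePair H) (s : IdempotentSplitting A.idem) :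
    (s.i ≫ A.data.projX) ≫ A.data.inr = s.i := by
  rw [Category.assoc, projX_inr, s.i_e]

theorem splitting_p_i_projX (A : AdmissiblePair H) (s : IdempotentSplitting A.idem) :
    s.p ≫ s.i ≫ A.data.projX = A.data.projX := by
  rw [reassoc_of% s.p_i, ← projX_inr, Category.assoc, A.data.inr_projX, Category.comp_id]

/-- The image of `Π` is identified with `X`, compatibly with all structure morphisms, by `i`
followed by the projection on `X`. -/
theorem isCrossedModuleBialgebraHom_coinvariants (A : AdmissiblePair H)
    (s : IdempotentSplitting A.idem) :
    CrossData.IsCrossedModuleBialgebraHom (A.toHopfBimoduleBialgebra s).coinvariants A.data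
      (s.i ≫ A.data.projX) := by
  have hM := A.property.isModuleAlgebra
  have hC := A.property.isComoduleCoalgebra
  have hi := splitting_i_projX_inr A s
  have hp := splitting_p_i_projX A s
  obtain ⟨f, hf⟩ : ∃ f : s.Y ⟶ A.data.X, s.i ≫ A.data.projX = f := ⟨_, rfl⟩
  rw [hf] at hi hp
  suffices h : CrossData.IsCrossedModuleBialgebraHom
      (A.toHopfBimoduleBialgebra s).coinvariants A.data f from
    (congrArg (fun g : s.Y ⟶ A.data.X => CrossData.IsCrossedModuleBialgebraHom
      (A.toHopfBimoduleBialgebra s).coinvariants A.data g) hf).mpr h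
  refine ⟨?_, ?_, ⟨?_, ?_⟩, ⟨?_, ?_⟩⟩
  · change (s.i ▷ H ≫ (_ ◁ A.data.inj ≫ A.data.crossMul) ≫ s.p) ≫ f = f ▷ H ≫ A.data.act
    simp only [Category.assoc]
    rw [hp, A.data.crossMul_projX, whisker_exchange_assoc, ← comp_whiskerRight_assoc, hf,
      hM.inj_crossAct]
  · change f ≫ A.data.coact = (s.i ≫ (A.data.crossComul ≫ _ ◁ A.data.proj) ≫ s.p ▷ H) ≫ f ▷ H
    simp only [Category.assoc]
    rw [← comp_whiskerRight, hp, ← MonoidalCategory.tensorHom_def', hC.projX_proj, ← hi,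
      Category.assoc, A.data.inr_coswap]
  · change (s.i ▷ s.Y ≫ (_ ◁ s.i ≫ A.data.crossMul) ≫ s.p) ≫ f = (f ⊗ₘ f) ≫ A.data.mul
    simp only [Category.assoc]
    rw [hp, A.data.crossMul_projX, whisker_exchange_assoc, ← comp_whiskerRight_assoc, hf,
      ← hM.inr_crossAct, ← hi, MonoidalCategory.whiskerLeft_comp_assoc,
      MonoidalCategory.tensorHom_def_assoc]
  · change (η[H] ≫ A.data.inj ≫ s.p) ≫ f = A.data.one
    simp only [Category.assoc]
    rw [hp, reassoc_of% hM.isAlgebraHom_inj.map_one, ← hM.isAlgebraHom_inr.map_one, Category.assoc,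
      A.data.inr_projX, Category.comp_id]
  · change f ≫ A.data.comul = (s.i ≫ (A.data.crossComul ≫ _ ◁ s.p) ≫ s.p ▷ s.Y) ≫ (f ⊗ₘ f)
    simp only [Category.assoc]
    rw [← MonoidalCategory.tensorHom_def'_assoc, tensorHom_comp_tensorHom, hp,
      ← hC.isCoalgebraHom_projX.map_comul, reassoc_of% hf]
  · change f ≫ A.data.counit = s.i ≫ A.data.proj ≫ ε[H]
    rw [hC.isCoalgebraHom_proj.map_counit, ← hC.isCoalgebraHom_projX.map_counit, reassoc_of% hf]

theorem coinvariants_canonicalSplitting (A : AdmissiblePair H) :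
    (A.toHopfBimoduleBialgebra (AdmissiblePair.canonicalSplitting A)).coinvariants = A.data := by
  have h := isCrossedModuleBialgebraHom_coinvariants A (AdmissiblePair.canonicalSplitting A)
  have h1 : (AdmissiblePair.canonicalSplitting A).i ≫ A.data.projX = 𝟙 A.data.X :=
    A.data.inr_projX
  exact CrossData.eq_of_isCrossedModuleBialgebraHom_id (h1 ▸ h)

theorem isIso_coinvariants (A : AdmissiblePair H) (s : IdempotentSplitting A.idem) :
    IsIso (s.i ≫ A.data.projX) := by
  refine ⟨A.data.inr ≫ s.p, ?_, ?_⟩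
  · rw [Category.assoc, reassoc_of% projX_inr, s.e_p, s.i_p]
  · rw [Category.assoc, splitting_p_i_projX, A.data.inr_projX]

/-- The crossed module bialgebra of coinvariants of `H ⋉ X`, formed with the splitting `s`. -/
def coinvariantsObj (A : AdmissiblePair H) (s : IdempotentSplitting A.idem) :
    CrossedModuleBialgebra H :=
  ⟨(A.toHopfBimoduleBialgebra s).coinvariants,
    @CrossData.IsCrossedModuleBialgebra.of_isIso _ _ _ _ _ _ _ _ _ (isIso_coinvariants A s)
      (isCrossedModuleBialgebraHom_coinvariants A s) A.property.isCrossedModuleBialgebra⟩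

/-- The coinvariants of `H ⋉ X` are isomorphic to `X`, for every splitting. -/
noncomputable def coinvariantsIso (A : AdmissiblePair H) (s : IdempotentSplitting A.idem) :
    coinvariantsObj A s ≅ ⟨A.data, A.property.isCrossedModuleBialgebra⟩ :=
  let f : coinvariantsObj A s ⟶ ⟨A.data, A.property.isCrossedModuleBialgebra⟩ :=
    ⟨_, isCrossedModuleBialgebraHom_coinvariants A s⟩
  haveI : IsIso f := @CrossedModuleBialgebra.isIso_of_isIso _ _ _ _ _ _ _ _ f
    (isIso_coinvariants A s)
  asIso f

theorem crossProductWellDefined (H : C) [BimonObj H] : CrossProductWellDefined H where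
  obj A := A.property.isAdmissible
  map f := f.property.isAdmissibleHom

open AdmissiblePair

/-- The restriction `X ⟶ Y` of a morphism of admissible pairs, as a morphism of crossed module
bialgebras. -/
def homRestrict {A B : AdmissiblePair H} (h : A ⟶ B) :
    (⟨A.data, A.property.isCrossedModuleBialgebra⟩ : CrossedModuleBialgebra H) ⟶
      ⟨B.data, B.property.isCrossedModuleBialgebra⟩ :=
  ⟨A.data.inr ≫ h.hom ≫ B.data.projX,
    h.property.isCrossedModuleBialgebraHom A.property B.property (inr_comp h) (comp_projX h)⟩

/-- The isomorphisms of the coinvariants with `X` are natural. -/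
theorem splitting_comp {A B : AdmissiblePair H} (h : A ⟶ B) (s : IdempotentSplitting A.idem)
    (t : IdempotentSplitting B.idem) :
    (s.i ≫ h.hom ≫ t.p) ≫ t.i ≫ B.data.projX =
      (s.i ≫ A.data.projX) ≫ A.data.inr ≫ h.hom ≫ B.data.projX := by
  simp only [Category.assoc]
  rw [splitting_p_i_projX, ← comp_projX]

theorem coinvariantsWellDefined (σ : SplittingChoice H) : CoinvariantsWellDefined σ where
  obj A := (coinvariantsObj A (σ A)).property
  map {A B} h := by
    -- The image of `h` is its restriction to `X`, conjugated by the isomorphisms with `X` and `Y`.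
    let g := (coinvariantsIso A (σ A)).hom ≫ homRestrict h ≫ (coinvariantsIso B (σ B)).inv
    have h1 : g.hom = (σ A).i ≫ h.hom ≫ (σ B).p := by
      have h2 : g.hom ≫ (σ B).i ≫ B.data.projX =
          ((σ A).i ≫ A.data.projX) ≫ A.data.inr ≫ h.hom ≫ B.data.projX :=
        congrArg CrossedModuleBialgebra.Hom.hom
          (show g ≫ (coinvariantsIso B (σ B)).hom = (coinvariantsIso A (σ A)).hom ≫ homRestrict h by
            simp [g])
      rw [← splitting_comp] at h2
      have := isIso_coinvariants B (σ B)
      exact (cancel_mono ((σ B).i ≫ B.data.projX)).1 h2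
    exact h1 ▸ g.property

theorem CrossedModuleBialgebra.eqToHom_comp_hom {H : C} [BimonObj H]
    {A A' B B' : CrossedModuleBialgebra H} (h : A' = A) (f : A ⟶ B) (h' : B = B') :
    (eqToHom h ≫ f ≫ eqToHom h').hom = eqToHom (congrArg (fun A => A.data.X) h) ≫ f.hom ≫
      eqToHom (congrArg (fun A => A.data.X) h') := by
  subst h h'
  rfl

theorem AdmissiblePair.eqToHom_comp_hom {H : C} [BimonObj H] {A A' B B' : AdmissiblePair H}
    (h : A' = A) (f : A ⟶ B) (h' : B = B') :
    (eqToHom h ≫ f ≫ eqToHom h').hom = eqToHom (congrArg (fun A => H ⊗ A.data.X) h) ≫ f.hom ≫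
      eqToHom (congrArg (fun A => H ⊗ A.data.X) h') := by
  subst h h'
  rfl

theorem CrossedModuleBialgebra.ext {A B : CrossedModuleBialgebra H} (h : A.data = B.data) :
    A = B := by
  cases A; cases B; cases h; rfl

theorem AdmissiblePair.ext {A B : AdmissiblePair H} (h : A.data = B.data) : A = B := by
  cases A; cases B; cases h; rfl

theorem crossProduct_comp_coinvariantsFunctor (w : CrossProductWellDefined H)
    (w' : CoinvariantsWellDefined (H := H) canonicalSplitting) :
    crossProduct w ⋙ coinvariantsFunctor canonicalSplitting w' = 𝟭 _ := by
  refine CategoryTheory.Functor.ext (fun A => CrossedModuleBialgebra.ext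
    (coinvariants_canonicalSplitting ((crossProduct w).obj A))) fun A B f =>
      CrossedModuleBialgebra.Hom.ext ?_
  refine Eq.trans ?_ (CrossedModuleBialgebra.eqToHom_comp_hom _ _ _).symm
  -- The underlying objects agree definitionally, so that the morphisms `eqToHom` are identities.
  change A.data.inr ≫ H ◁ f.hom ≫ B.data.projX =
      𝟙 A.data.X ≫ f.hom ≫ 𝟙 B.data.X
  rw [CrossData.whiskerLeft_projX, reassoc_of% A.data.inr_projX, Category.id_comp, Category.comp_id]

theorem coinvariantsFunctor_comp_crossProduct (w : CrossProductWellDefined H)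
    (w' : CoinvariantsWellDefined (H := H) canonicalSplitting) :
    coinvariantsFunctor canonicalSplitting w' ⋙ crossProduct w = 𝟭 _ := by
  refine CategoryTheory.Functor.ext (fun A => AdmissiblePair.ext
    (coinvariants_canonicalSplitting A)) fun A B f => AdmissiblePair.Hom.ext ?_
  refine Eq.trans ?_ (AdmissiblePair.eqToHom_comp_hom _ _ _).symm
  -- The underlying objects agree definitionally, so that the morphisms `eqToHom` are identities.
  change H ◁ (A.data.inr ≫ f.hom ≫ B.data.projX) =
      𝟙 (H ⊗ A.data.X) ≫ f.hom ≫ 𝟙 (H ⊗ B.data.X)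
  rw [← hom_eq_whiskerLeft, Category.id_comp, Category.comp_id]

theorem nonempty_coinvariantsFunctor_iso (σ τ : SplittingChoice H) (w : CoinvariantsWellDefined σ)
    (w' : CoinvariantsWellDefined τ) :
    Nonempty (coinvariantsFunctor σ w ≅ coinvariantsFunctor τ w') := by
  let e (ρ : SplittingChoice H) (wρ : CoinvariantsWellDefined ρ) (A : AdmissiblePair H) :
      (coinvariantsFunctor ρ wρ).obj A ≅ ⟨A.data, A.property.isCrossedModuleBialgebra⟩ :=
    coinvariantsIso A (ρ A)
  have he (ρ : SplittingChoice H) (wρ : CoinvariantsWellDefined ρ) {A B : AdmissiblePair H}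
      (h : A ⟶ B) :
      (coinvariantsFunctor ρ wρ).map h ≫ (e ρ wρ B).hom = (e ρ wρ A).hom ≫ homRestrict h :=
    CrossedModuleBialgebra.Hom.ext (splitting_comp h (ρ A) (ρ B))
  refine ⟨NatIso.ofComponents (fun A => e σ w A ≪≫ (e τ w' A).symm) fun {A B} h => ?_⟩
  rw [Iso.trans_hom, Iso.trans_hom, Iso.symm_hom, Iso.symm_hom, reassoc_of% he σ w h,
    Category.assoc, ← cancel_mono (e τ w' B).hom]
  simp [he τ w' h]

end

end BraidedCross

open BraidedCross BraidedCross.AdmissiblePair in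
theorem mainTheorem3 {C : Type u} [Category.{v} C] [MonoidalCategory.{v} C] [BraidedCategory C]
    (H : C) [HopfObj H] [IsIso (HopfObj.antipode (X := H))] :
    ∃ (w : CrossProductWellDefined H)
      (w' : ∀ σ : SplittingChoice H, CoinvariantsWellDefined σ),
      crossProduct w ⋙ coinvariantsFunctor canonicalSplitting (w' canonicalSplitting) =
          𝟭 (CrossedModuleBialgebra H) ∧
        coinvariantsFunctor canonicalSplitting (w' canonicalSplitting) ⋙ crossProduct w =
          𝟭 (AdmissiblePair H) ∧
        ∀ σ : SplittingChoice H,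
          Nonempty (coinvariantsFunctor σ (w' σ) ≅
            coinvariantsFunctor canonicalSplitting (w' canonicalSplitting)) :=
  ⟨crossProductWellDefined H, coinvariantsWellDefined,
    crossProduct_comp_coinvariantsFunctor _ _, coinvariantsFunctor_comp_crossProduct _ _,
    fun _ => nonempty_coinvariantsFunctor_iso _ _ _ _⟩
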